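/- Let $\mathbf R^4_1$ be $\mathbf R^4$ with the inner product $\langle x,y\rangle=-x_0y_0+x_1y_1+x_2y_2+x_3y_3$, and let $S^3_1=\{x\in\mathbf R^4_1 ; \langle x,x\rangle=1\}$ be de Sitter 3-space. For $\mu>0$, $\mu\neq 1$, put $$x_0(s)=\sinh s\cosh \mu s-\frac{(\mu^2+1)\cosh s\sinh\mu s}{2\mu},\qquad x_3(s)=\cosh s\cosh \mu s-\frac{(\mu^2+1)\sinh s\sinh\mu s}{2\mu},$$ and, with $T^1=\mathbf R/2\pi\mathbf Z$, define the G-catenoid of type TE, $f^\mu_{\mathrm{TE}}:\mathbf R\times T^1\to S^3_1$, by $$f^\mu_{\mathrm{TE}}(s,\theta)=\Bigl(x_0(s),\ \tfrac{1-\mu^2}{2\mu}\sinh(\mu s)\cos\theta,\ \tfrac{1-\mu^2}{2\mu}\sinh(\mu s)\sin\theta,\ x_3(s)\Bigr).$$ Let $$\mathcal X^\mu_{\mathrm{TE}}=\Bigl\{(\xi,\eta,s)\in\mathbf R^3 ; \xi^2+\eta^2=\bigl(\tfrac{1-\mu^2}{2\mu}\bigr)^2\sinh^2\mu s\Bigr\},\qquad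 \tilde f^\mu_{\mathrm{TE}}:\mathcal X^\mu_{\mathrm{TE}}\to S^3_1,\quad \tilde f^\mu_{\mathrm{TE}}(\xi,\eta,s)=(x_0(s),\xi,\eta,x_3(s)).$$ Definitions. A (2-dimensional, real analytic) *DC-manifold* (double-cone manifold) is a locally compact, Hausdorff, second countable space with an atlas of homeomorphisms from open sets onto connected open subsets of the double cone $\mathcal C=\{a\in\mathbf R^3 ; a_1^2+a_2^2=a_3^2\}$ whose transition maps are real analytic, that is, restrictions of real analytic maps defined on open subsets of $\mathbf R^3$; *DC-coordinates* are homeomorphisms from open sets onto open subsets of $\mathcal C$ that are analytically compatible with the atlas; the *DC-points* are those sent to the origin by DC-coordinates. A map $f$ from a DC-manifold $X$ to $S^3_1$ is a *real analytic DC-immersion* if it is real analytic in the charts and if every $p\in X$ has DC-coordinates $(U,\phi)$ around it for which there is a real analytic diffeomorphism $\Phi$ from an open set of $S^3_1$ containing $f(U)$ onto an open set of $\mathbf R^3$ with $\Phi\circ f\circ\phi^{-1}(a)=a$ for all $a\in\phi(U)$. If moreover $X$ is connected and $f$ restricted to the set of points that are not DC-points is a space-like immersion (its induced metric is positive definite)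 whose mean curvature (half the trace of the shape operator) with respect to a suitable continuous unit normal field is identically $1$, then $f$ is called a *real analytic space-like CMC-1 DC-immersion*. A non-empty set $S\subset S^3_1$ is *analytically complete* if every real analytic $\Gamma:[0,1]\to S^3_1$ with $\Gamma([0,\varepsilon))\subset S$ for some $\varepsilon\in(0,1)$ satisfies $\Gamma([0,1])\subset S$. Proposition. Let $\mu>0$, $\mu\ne1$, and give $\mathcal X^\mu_{\mathrm{TE}}$ the DC-manifold structure defined by the global chart $(\xi,\eta,s)\mapsto(\xi,\eta,\frac{1-\mu^2}{2\mu}\sinh\mu s)$ onto $\mathcal C$. Its only DC-point is $(0,0,0)$. The map $f^\mu_{\mathrm{TE}}$ is real analytic and is realized as a real analytic space-like CMC-1 DC-immersion as follows: $f^\mu_{\mathrm{TE}}=\tilde f^\mu_{\mathrm{TE}}\circ\pi$, where $\pi:\mathbf R\times T^1\to\mathcal X^\mu_{\mathrm{TE}}$, $\pi(s,\theta)=(\frac{1-\mu^2}{2\mu}\sinh(\mu s)\cos\theta,\frac{1-\mu^2}{2\mu}\sinh(\mu s)\sin\theta,s)$, is surjective, and $\tilde f^\mu_{\mathrm{TE}}$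 is a proper real analytic space-like CMC-1 DC-immersion. In particular $f^\mu_{\mathrm{TE}}$ and $\tilde f^\mu_{\mathrm{TE}}$ have the same image, and this image is analytically complete in $S^3_1$. -/

import Mathlib

open Set

/-! ## Double-cone manifolds -/

/-- The `m`-dimensional standard double cone `x₁² + ⋯ + x_m² = x_{m+1}²` in `ℝ^{m+1}`.
Its origin is the standard double-cone point. -/
def doubleCone (m : ℕ) : Set (Fin (m + 1) → ℝ) :=
  {x | ∑ j : Fin m, x j.castSucc ^ 2 = x (Fin.last m) ^ 2}

/-- `g` is real analytic on the open subset `A` of the double cone: it is the restriction to `A`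
of a real analytic map defined on an open set `Ω` of the ambient space whose trace on the
cone is `A`. Maps into another double cone are regarded as maps into its ambient space. -/
def ConeAnalyticOn {m k : ℕ} (g : doubleCone m → (Fin k → ℝ)) (A : Set (doubleCone m)) : Prop :=
  ∃ (Ω : Set (Fin (m + 1) → ℝ)) (G : (Fin (m + 1) → ℝ) → (Fin k → ℝ)),
    IsOpen Ω ∧ AnalyticOnNhd ℝ G Ω ∧ Subtype.val ⁻¹' Ω = A ∧
      ∀ a ∈ A, G (a : Fin (m + 1) → ℝ) = g a

/-- The coordinate change from `φ` to `ψ` is real analytic. -/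
def AnalyticTransition {m : ℕ} {X : Type*} [TopologicalSpace X]
    (φ ψ : OpenPartialHomeomorph X (doubleCone m)) : Prop :=
  ConeAnalyticOn (fun a => (ψ (φ.symm a) : Fin (m + 1) → ℝ)) (φ.symm.trans ψ).source

/-- An `m`-dimensional real analytic double-cone manifold structure on the space `X`. -/
structure DCStructure (m : ℕ) (X : Type*) [TopologicalSpace X] where
  locallyCompact : LocallyCompactSpace X
  hausdorff : T2Space X
  secondCountable : SecondCountableTopology X
  /-- The charts; the domain of a chart `φ` is `φ.source`. -/
  atlas : Set (OpenPartialHomeomorph X (doubleCone m))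
  cover : ∀ p : X, ∃ φ ∈ atlas, p ∈ φ.source
  connected_target : ∀ φ ∈ atlas, IsConnected φ.target
  analytic_transition : ∀ φ ∈ atlas, ∀ ψ ∈ atlas, AnalyticTransition φ ψ

namespace DCStructure

variable {m : ℕ} {X : Type*} [TopologicalSpace X]

/-- Local DC-coordinate systems: those compatible with all charts of the structure. -/
def IsChart (D : DCStructure m X) (ψ : OpenPartialHomeomorph X (doubleCone m)) : Prop :=
  ∀ φ ∈ D.atlas, AnalyticTransition ψ φ ∧ AnalyticTransition φ ψ

/-- DC-points: points sent to the double-cone point by a local DC-coordinate system. -/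
def IsDCPoint (D : DCStructure m X) (p : X) : Prop :=
  ∃ ψ, D.IsChart ψ ∧ p ∈ ψ.source ∧ (ψ p : Fin (m + 1) → ℝ) = 0

/-- DC-analytic maps into a real analytic submanifold `N` of `ℝ^k`. -/
def IsDCAnalytic (D : DCStructure m X) {k : ℕ} {N : Set (Fin k → ℝ)} (f : X → N) : Prop :=
  ∀ φ ∈ D.atlas, ConeAnalyticOn (fun a => (f (φ.symm a) : Fin k → ℝ)) φ.target

end DCStructure

/-- `Φ` is a real analytic diffeomorphism from an open subset of the `n`-dimensional
real analytic submanifold `N` of `ℝ^k` onto an open subset of `ℝ^n`. -/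
def IsAnalyticDiffeo {k n : ℕ} {N : Set (Fin k → ℝ)}
    (Φ : OpenPartialHomeomorph N (Fin n → ℝ)) : Prop :=
  (∃ (O : Set (Fin k → ℝ)) (G : (Fin k → ℝ) → (Fin n → ℝ)),
    IsOpen O ∧ AnalyticOnNhd ℝ G O ∧ Subtype.val ⁻¹' O = Φ.source ∧
      ∀ y ∈ Φ.source, G (y : Fin k → ℝ) = Φ y) ∧
  AnalyticOnNhd ℝ (fun z => (Φ.symm z : Fin k → ℝ)) Φ.target

/-- The vector `(a, 0) ∈ ℝ^n` for `a ∈ ℝ^{m+1}`, `m + 1 ≤ n`. -/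
def padZero {m : ℕ} (n : ℕ) (a : Fin (m + 1) → ℝ) : Fin n → ℝ :=
  fun i => if h : (i : ℕ) < m + 1 then a ⟨i, h⟩ else 0

namespace DCStructure

variable {m : ℕ} {X : Type*} [TopologicalSpace X]

/-- DC-regular points of a map into an `n`-dimensional real analytic submanifold `N` of `ℝ^k`:
in suitable analytic coordinates `φ`, `Φ` the map is the inclusion `a ↦ (a, 0)` of an open piece
of the double cone into `ℝ^n`. -/
def IsDCRegularAt (D : DCStructure m X) {k : ℕ} {N : Set (Fin k → ℝ)} (n : ℕ) (f : X → N)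
    (p : X) : Prop :=
  ∃ (φ : OpenPartialHomeomorph X (doubleCone m)) (Φ : OpenPartialHomeomorph N (Fin n → ℝ)),
    D.IsChart φ ∧ p ∈ φ.source ∧ IsAnalyticDiffeo Φ ∧
      ∀ a ∈ φ.target, f (φ.symm a) ∈ Φ.source ∧
        Φ (f (φ.symm a)) = padZero n (a : Fin (m + 1) → ℝ)

/-- Real analytic DC-immersions into an `n`-dimensional real analytic submanifold `N` of `ℝ^k`. -/
structure IsDCImmersion (D : DCStructure m X) {k : ℕ} {N : Set (Fin k → ℝ)} (n : ℕ)
    (f : X → N) : Prop where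
  dim_lt : m < n
  analytic : D.IsDCAnalytic f
  regular : ∀ p, D.IsDCRegularAt n f p

/-- `x : W → X` is a local parametrization (by an open set `W ⊆ ℝ^m`) of the ordinary
`m`-dimensional real analytic manifold formed by the points of `X` that are not DC-points:
an analytic immersion between manifolds of equal dimension, i.e. a local diffeomorphism. -/
structure IsLocalParam (D : DCStructure m X) (W : Set (Fin m → ℝ)) (x : (Fin m → ℝ) → X) :
    Prop where
  isOpen : IsOpen W
  continuousOn : ContinuousOn x W
  not_dcPoint : ∀ u ∈ W, ¬ D.IsDCPoint (x u)
  analytic : ∀ φ ∈ D.atlas,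
    AnalyticOnNhd ℝ (fun u => (φ (x u) : Fin (m + 1) → ℝ)) (W ∩ x ⁻¹' φ.source)
  immersive : ∀ φ ∈ D.atlas, ∀ u ∈ W ∩ x ⁻¹' φ.source,
    Function.Injective (fderiv ℝ (fun u => (φ (x u) : Fin (m + 1) → ℝ)) u)

end DCStructure

/-! ## Analytic completeness -/

/-- Analytically complete subsets of a real analytic submanifold `N` of `ℝ^k`. -/
def IsAnalyticallyComplete {k : ℕ} {N : Set (Fin k → ℝ)} (S : Set N) : Prop :=
  S.Nonempty ∧ ∀ Γ : ℝ → N, AnalyticOn ℝ (fun t => (Γ t : Fin k → ℝ)) (Icc 0 1) →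
    (∃ ε ∈ Ioo (0 : ℝ) 1, ∀ t ∈ Ico 0 ε, Γ t ∈ S) → ∀ t ∈ Icc (0 : ℝ) 1, Γ t ∈ S

/-! ## Space-like CMC-1 surfaces in de Sitter 3-space -/

/-- The Lorentz-Minkowski inner product of signature `(-+++)` on `ℝ⁴`. -/
def lorentz (x y : Fin 4 → ℝ) : ℝ := -(x 0 * y 0) + x 1 * y 1 + x 2 * y 2 + x 3 * y 3

/-- De Sitter 3-space `S³₁`. -/
def deSitter : Set (Fin 4 → ℝ) := {x | lorentz x x = 1}

section SurfaceGeometry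

/-- The partial derivative `∂g/∂uᵢ`. -/
noncomputable def partialD (i : Fin 2) (g : (Fin 2 → ℝ) → (Fin 4 → ℝ)) (u : Fin 2 → ℝ) :
    Fin 4 → ℝ :=
  fderiv ℝ g u (Pi.single i 1)

/-- The matrix of the first fundamental form of the parametrized surface `g`. -/
noncomputable def firstForm (g : (Fin 2 → ℝ) → (Fin 4 → ℝ)) (u : Fin 2 → ℝ) :
    Matrix (Fin 2) (Fin 2) ℝ :=
  Matrix.of fun i j => lorentz (partialD i g u) (partialD j g u)

/-- The matrix of the second fundamental form of `g` with respect to the normal vector `n`. -/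
noncomputable def secondForm (g : (Fin 2 → ℝ) → (Fin 4 → ℝ)) (n : Fin 4 → ℝ) (u : Fin 2 → ℝ) :
    Matrix (Fin 2) (Fin 2) ℝ :=
  Matrix.of fun i j => lorentz (partialD i (partialD j g) u) n

/-- The mean curvature of `g` at `u` with respect to the unit normal vector `n`. -/
noncomputable def meanCurvature (g : (Fin 2 → ℝ) → (Fin 4 → ℝ)) (n : Fin 4 → ℝ)
    (u : Fin 2 → ℝ) : ℝ :=
  (1 / 2) * ((firstForm g u)⁻¹ * secondForm g n u).trace

/-- `n` is a (time-like) unit normal vector at `u` of the surface `g` in `S³₁`: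
it is tangent to `S³₁` and orthogonal to the surface. -/
def IsUnitNormal (g : (Fin 2 → ℝ) → (Fin 4 → ℝ)) (n : Fin 4 → ℝ) (u : Fin 2 → ℝ) : Prop :=
  lorentz n n = -1 ∧ lorentz n (g u) = 0 ∧ ∀ i, lorentz n (partialD i g u) = 0

end SurfaceGeometry

/-- Real analytic space-like CMC-1 DC-immersions into `S³₁`, defined on a connected
2-dimensional DC-manifold: away from the DC-points the induced metric is positive definite
(so the map is a space-like immersion there) and the mean curvature with respect to some continuous
unit normal field `ν` is identically `1`. -/
structure IsSpacelikeCMC1DCImmersion {X : Type*} [TopologicalSpace X] (D : DCStructure 2 X)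
    (f : X → deSitter) : Prop where
  connected : ConnectedSpace X
  dcImmersion : D.IsDCImmersion 3 f
  spacelike_cmc1 : ∃ ν : X → (Fin 4 → ℝ), ContinuousOn ν {p | ¬ D.IsDCPoint p} ∧
    ∀ p, ¬ D.IsDCPoint p →
      ∃ (W : Set (Fin 2 → ℝ)) (x : (Fin 2 → ℝ) → X) (u : Fin 2 → ℝ),
        D.IsLocalParam W x ∧ u ∈ W ∧ x u = p ∧
        (firstForm (fun v => (f (x v) : Fin 4 → ℝ)) u).PosDef ∧
        IsUnitNormal (fun v => (f (x v) : Fin 4 → ℝ)) (ν p) u ∧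
        meanCurvature (fun v => (f (x v) : Fin 4 → ℝ)) (ν p) u = 1

/-! ## G-catenoids of type TE -/

/-- The component `x₀(s)` of the profile curve. -/
noncomputable def teX0 (μ s : ℝ) : ℝ :=
  Real.sinh s * Real.cosh (μ * s) - (μ ^ 2 + 1) * Real.cosh s * Real.sinh (μ * s) / (2 * μ)

/-- The component `x₃(s)` of the profile curve. -/
noncomputable def teX3 (μ s : ℝ) : ℝ :=
  Real.cosh s * Real.cosh (μ * s) - (μ ^ 2 + 1) * Real.sinh s * Real.sinh (μ * s) / (2 * μ)

/-- The profile curve. -/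
noncomputable def teProfile (μ s : ℝ) : Fin 4 → ℝ :=
  ![teX0 μ s, (1 - μ ^ 2) / (2 * μ) * Real.sinh (μ * s), 0, teX3 μ s]

/-- The rotation by the angle `θ` in the `(x₁, x₂)`-plane. -/
noncomputable def teRotation (θ : Real.Angle) : Matrix (Fin 4) (Fin 4) ℝ :=
  !![1, 0, 0, 0;
     0, θ.cos, -θ.sin, 0;
     0, θ.sin, θ.cos, 0;
     0, 0, 0, 1]

lemma te_identity {μ : ℝ} (hμ : 0 < μ) (s : ℝ) :
    -(teX0 μ s * teX0 μ s) + ((1 - μ ^ 2) / (2 * μ)) ^ 2 * Real.sinh (μ * s) ^ 2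
      + teX3 μ s * teX3 μ s = 1 := by
  have h1 := Real.cosh_sq s
  have h2 := Real.cosh_sq (μ * s)
  have hne : μ ≠ 0 := hμ.ne'
  unfold teX0 teX3
  field_simp
  linear_combination (4 * μ ^ 2 * Real.cosh (μ * s) ^ 2
    - (μ ^ 2 + 1) ^ 2 * Real.sinh (μ * s) ^ 2) * h1 + 4 * μ ^ 2 * h2

/-- The G-catenoid of type TE, `f_TE^μ : ℝ × T¹ → S³₁`, where `T¹ = ℝ / 2πℤ`. -/
noncomputable def fTE (μ : ℝ) (hμ : 0 < μ) (q : ℝ × Real.Angle) : deSitter :=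
  ⟨(teRotation q.2).mulVec (teProfile μ q.1), by
    have h := te_identity hμ q.1
    have hc := Real.Angle.cos_sq_add_sin_sq q.2
    simp only [deSitter, lorentz, mem_ofPred_eq, teRotation, teProfile, Matrix.mulVec, dotProduct,
      Fin.sum_univ_four, Matrix.of_apply, Matrix.cons_val]
    linear_combination h + ((1 - μ ^ 2) / (2 * μ)) ^ 2 * Real.sinh (μ * q.1) ^ 2 * hc⟩

/-- The surface `X_TE^μ = {(ξ, η, s) | ξ² + η² = ((1 - μ²) / 2μ)² sinh² μs}` in `ℝ³`. -/
def surfaceTE (μ : ℝ) : Set (Fin 3 → ℝ) :=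
  {p | p 0 ^ 2 + p 1 ^ 2 = ((1 - μ ^ 2) / (2 * μ)) ^ 2 * Real.sinh (μ * p 2) ^ 2}

/-- The map `(ξ, η, s) ↦ (x₀(s), ξ, η, x₃(s))` from `X_TE^μ` to `S³₁`. -/
noncomputable def fTETilde (μ : ℝ) (hμ : 0 < μ) (p : surfaceTE μ) : deSitter :=
  ⟨![teX0 μ (p.1 2), p.1 0, p.1 1, teX3 μ (p.1 2)], by
    have h := te_identity hμ (p.1 2)
    have hp : p.1 0 ^ 2 + p.1 1 ^ 2 = _ := p.2
    simp only [deSitter, lorentz, mem_ofPred_eq, Matrix.cons_val]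
    linear_combination h + hp⟩

/-- The map `ℝ × T¹ → X_TE^μ`, `(s, θ) ↦ (x₁(s, θ), x₂(s, θ), s)`. -/
noncomputable def teProj (μ : ℝ) (hμ : 0 < μ) (q : ℝ × Real.Angle) : surfaceTE μ :=
  ⟨![(fTE μ hμ q : Fin 4 → ℝ) 1, (fTE μ hμ q : Fin 4 → ℝ) 2, q.1], by
    have hc := Real.Angle.cos_sq_add_sin_sq q.2
    simp only [surfaceTE, fTE, mem_ofPred_eq, teRotation, teProfile, Matrix.mulVec, dotProduct,
      Fin.sum_univ_four, Matrix.of_apply, Matrix.cons_val]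
    linear_combination ((1 - μ ^ 2) / (2 * μ)) ^ 2 * Real.sinh (μ * q.1) ^ 2 * hc⟩

lemma te_const_ne_zero {μ : ℝ} (hμ : 0 < μ) (hμ1 : μ ≠ 1) : (1 - μ ^ 2) / (2 * μ) ≠ 0 := by
  have h : 1 - μ ^ 2 ≠ 0 := by
    intro h
    have : (1 - μ) * (1 + μ) = 0 := by linear_combination h
    rcases mul_eq_zero.1 this with h | h
    · exact hμ1 (by linarith)
    · linarith
  positivity

/-- The homeomorphism `(ξ, η, s) ↦ (ξ, η, ((1 - μ²) / 2μ) sinh μs)` from `X_TE^μ` onto the standard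
double cone; it is the restriction of a real analytic diffeomorphism of `ℝ³`. -/
noncomputable def teHomeomorph (μ : ℝ) (hμ : 0 < μ) (hμ1 : μ ≠ 1) :
    surfaceTE μ ≃ₜ doubleCone 2 where
  toFun p := ⟨![p.1 0, p.1 1, (1 - μ ^ 2) / (2 * μ) * Real.sinh (μ * p.1 2)], by
    have hp : p.1 0 ^ 2 + p.1 1 ^ 2 = _ := p.2
    simp only [doubleCone, mem_ofPred_eq, Fin.sum_univ_two]
    change p.1 0 ^ 2 + p.1 1 ^ 2 = ((1 - μ ^ 2) / (2 * μ) * Real.sinh (μ * p.1 2)) ^ 2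
    rw [hp, mul_pow]⟩
  invFun a := ⟨![a.1 0, a.1 1, Real.arsinh (a.1 2 / ((1 - μ ^ 2) / (2 * μ))) / μ], by
    have ha : ∑ j : Fin 2, a.1 j.castSucc ^ 2 = a.1 (Fin.last 2) ^ 2 := a.2
    rw [Fin.sum_univ_two] at ha
    change a.1 0 ^ 2 + a.1 1 ^ 2 = a.1 2 ^ 2 at ha
    have hc := te_const_ne_zero hμ hμ1
    have hne : μ ≠ 0 := hμ.ne'
    simp only [surfaceTE, mem_ofPred_eq, Matrix.cons_val]
    rw [mul_div_cancel₀ _ hne, Real.sinh_arsinh, ha, ← mul_pow, mul_div_cancel₀ _ hc]⟩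
  left_inv p := by
    have hc := te_const_ne_zero hμ hμ1
    have hne : μ ≠ 0 := hμ.ne'
    apply Subtype.ext
    funext i
    fin_cases i
    · rfl
    · rfl
    · change Real.arsinh ((1 - μ ^ 2) / (2 * μ) * Real.sinh (μ * p.1 2)
        / ((1 - μ ^ 2) / (2 * μ))) / μ = p.1 2
      rw [mul_div_cancel_left₀ _ hc, Real.arsinh_sinh, mul_div_cancel_left₀ _ hne]
  right_inv a := by
    have hc := te_const_ne_zero hμ hμ1
    have hne : μ ≠ 0 := hμ.ne'
    apply Subtype.ext
    funext i
    fin_cases i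
    · rfl
    · rfl
    · change (1 - μ ^ 2) / (2 * μ) * Real.sinh (μ * (Real.arsinh (a.1 2
        / ((1 - μ ^ 2) / (2 * μ))) / μ)) = a.1 2
      rw [mul_div_cancel₀ _ hne, Real.sinh_arsinh, mul_div_cancel₀ _ hc]
  continuous_toFun := by
    refine Continuous.subtype_mk (continuous_pi fun i => ?_) _
    fin_cases i
    · change Continuous fun p : surfaceTE μ => p.1 0
      exact (continuous_apply 0).comp continuous_subtype_val
    · change Continuous fun p : surfaceTE μ => p.1 1
      exact (continuous_apply 1).comp continuous_subtype_val
    · exact continuous_const.mul (Real.continuous_sinh.comp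
        (continuous_const.mul ((continuous_apply 2).comp continuous_subtype_val)))
  continuous_invFun := by
    refine Continuous.subtype_mk (continuous_pi fun i => ?_) _
    fin_cases i
    · change Continuous fun p : doubleCone 2 => p.1 0
      exact (continuous_apply 0).comp continuous_subtype_val
    · change Continuous fun p : doubleCone 2 => p.1 1
      exact (continuous_apply 1).comp continuous_subtype_val
    · exact (Real.continuous_arsinh.comp
        (((continuous_apply 2).comp continuous_subtype_val).div_const _)).div_const _

lemma isConnected_doubleCone (m : ℕ) : IsConnected (univ : Set (doubleCone m)) := by
  have h : StarConvex ℝ 0 (doubleCone m) := by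
    rw [starConvex_zero_iff]
    intro x hx a _ _
    have hx' : ∑ j : Fin m, x j.castSucc ^ 2 = x (Fin.last m) ^ 2 := hx
    simp only [doubleCone, mem_ofPred_eq, Pi.smul_apply, smul_eq_mul, mul_pow]
    rw [← Finset.mul_sum, hx']
  have h0 : (0 : Fin (m + 1) → ℝ) ∈ doubleCone m := by simp [doubleCone]
  have hc : IsConnected (doubleCone m) := (h.isPathConnected h0).isConnected
  have := isConnected_iff_connectedSpace.1 hc
  exact isConnected_univ

lemma isClosed_surfaceTE (μ : ℝ) : IsClosed (surfaceTE μ) := by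
  refine isClosed_eq (by fun_prop) ?_
  exact continuous_const.mul ((Real.continuous_sinh.comp
    (continuous_const.mul (continuous_apply 2))).pow 2)

/-- The DC-manifold structure of `X_TE^μ`, given by the single global chart `teHomeomorph`. -/
noncomputable def surfaceTE.dcStructure (μ : ℝ) (hμ : 0 < μ) (hμ1 : μ ≠ 1) :
    DCStructure 2 (surfaceTE μ) where
  locallyCompact := (isClosed_surfaceTE μ).locallyCompactSpace
  hausdorff := inferInstance
  secondCountable := inferInstance
  atlas := {(teHomeomorph μ hμ hμ1).toOpenPartialHomeomorph}
  cover p := ⟨_, rfl, mem_univ p⟩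
  connected_target := by
    rintro φ rfl
    exact isConnected_doubleCone 2
  analytic_transition := by
    rintro φ rfl ψ rfl
    refine ⟨univ, id, isOpen_univ, analyticOnNhd_id, ?_, fun a _ => ?_⟩
    · simp
    · simp

/-! Write c = (1 - μ²)/(2μ). Polar coordinates with signed radius c sinh μs turn the cone relation
into the parametrization by (s, θ), which gives the factorization and the equality of images.

DC-points. A vertex must stay a vertex under analytic coordinate changes
(`eq_zero_of_doubleCone_leftInverse`). The cone spans ℝ³ and is a union of lines through 0, so the
derivative of a coordinate change at 0 is determined by these lines and is invertible. If 0 went to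
q ≠ 0, differentiating the cone equation would put the image of this derivative in a plane.

DC-immersion. Near each point of the image, one of the maps y ↦ (y₁, y₂, y₃ ± y₀) is a chart of de
Sitter space. There the map reads a ↦ (a₀, a₁, p(a₂)) on the cone with p'(0) ≠ 0. Adding a multiple
of a₀² + a₁² - a₂², which is 0 on the cone, makes it a local diffeomorphism of ℝ³ near any chosen
point (`exists_openPartialHomeomorph_eqOn_doubleCone`). Undoing that diffeomorphism gives the normal
form.

Mean curvature. Polar coordinates are conformal with factor E = (c sinh μs)², so only the pairing of
f_ss + f_θθ with the normal is needed, and it equals 2E. Everything reduces to polynomial identities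
modulo μ² + 2cμ = 1 and the hyperbolic and circular Pythagorean relations.

Properness. Bounds on x₁ and x₂ bound sinh μs, hence s.

Analytic completeness. The image is cut out of de Sitter space by x₃ = F(√(x₁² + x₂²)) with F
analytic and even. Evenness makes the right-hand side analytic along analytic curves even across the
axis, so the identity theorem propagates the equation along the curve. -/

/-! ### Coordinate formulas, analyticity and factorization through the cone surface. -/

theorem fTE_coe (μ : ℝ) (hμ : 0 < μ) (s θ : ℝ) :
    (fTE μ hμ (s, (θ : Real.Angle)) : Fin 4 → ℝ) =
      ![teX0 μ s, (1 - μ ^ 2) / (2 * μ) * Real.sinh (μ * s) * Real.cos θ,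
        (1 - μ ^ 2) / (2 * μ) * Real.sinh (μ * s) * Real.sin θ, teX3 μ s] := by
  ext i
  fin_cases i <;>
    simp [fTE, teRotation, teProfile, mul_comm]

theorem teProj_coe (μ : ℝ) (hμ : 0 < μ) (s θ : ℝ) :
    (teProj μ hμ (s, (θ : Real.Angle)) : Fin 3 → ℝ) =
      ![(1 - μ ^ 2) / (2 * μ) * Real.sinh (μ * s) * Real.cos θ,
        (1 - μ ^ 2) / (2 * μ) * Real.sinh (μ * s) * Real.sin θ, s] := by
  simp only [teProj, fTE_coe]
  simp

theorem contDiff_teX0 (μ : ℝ) {n : WithTop ℕ∞} : ContDiff ℝ n (teX0 μ) := by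
  have h1 : ContDiff ℝ n fun s : ℝ => Real.cosh (μ * s) :=
    Real.contDiff_cosh.comp (contDiff_const.mul contDiff_id)
  have h2 : ContDiff ℝ n fun s : ℝ => Real.sinh (μ * s) :=
    Real.contDiff_sinh.comp (contDiff_const.mul contDiff_id)
  exact (Real.contDiff_sinh.mul h1).sub
    (((contDiff_const.mul Real.contDiff_cosh).mul h2).div_const _)

theorem contDiff_teX3 (μ : ℝ) {n : WithTop ℕ∞} : ContDiff ℝ n (teX3 μ) := by
  have h1 : ContDiff ℝ n fun s : ℝ => Real.cosh (μ * s) :=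
    Real.contDiff_cosh.comp (contDiff_const.mul contDiff_id)
  have h2 : ContDiff ℝ n fun s : ℝ => Real.sinh (μ * s) :=
    Real.contDiff_sinh.comp (contDiff_const.mul contDiff_id)
  exact (Real.contDiff_cosh.mul h1).sub
    (((contDiff_const.mul Real.contDiff_sinh).mul h2).div_const _)

theorem contDiff_const_mul_sinh (μ c : ℝ) {n : WithTop ℕ∞} :
    ContDiff ℝ n fun s : ℝ => c * Real.sinh (μ * s) :=
  contDiff_const.mul (Real.contDiff_sinh.comp (contDiff_const.mul contDiff_id))

/-- Here `⊤ : WithTop ℕ∞` is ω, so the hypothesis is analyticity and not just smoothness.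
Analyticity can thus be proved with the `ContDiff` calculus. -/
theorem ContDiff.analyticOnNhd_of_omega {E F : Type*} [NormedAddCommGroup E] [NormedSpace ℝ E]
    [NormedAddCommGroup F] [NormedSpace ℝ F] [CompleteSpace F] {f : E → F}
    (hf : ContDiff ℝ ⊤ f) (s : Set E) : AnalyticOnNhd ℝ f s :=
  fun x _ => (hf.contDiffAt (x := x)).analyticAt

theorem analyticOnNhd_fTE (μ : ℝ) (hμ : 0 < μ) :
    AnalyticOnNhd ℝ (fun q : ℝ × ℝ => (fTE μ hμ (q.1, (q.2 : Real.Angle)) : Fin 4 → ℝ)) univ := by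
  apply ContDiff.analyticOnNhd_of_omega
  simp only [fTE_coe]
  have h1 : ContDiff ℝ ⊤ fun q : ℝ × ℝ => (1 - μ ^ 2) / (2 * μ) * Real.sinh (μ * q.1) :=
    (contDiff_const_mul_sinh μ _).comp contDiff_fst
  rw [contDiff_pi]
  intro i
  fin_cases i
  · exact (contDiff_teX0 μ).comp contDiff_fst
  · exact h1.mul (Real.contDiff_cos.comp contDiff_snd)
  · exact h1.mul (Real.contDiff_sin.comp contDiff_snd)
  · exact (contDiff_teX3 μ).comp contDiff_fst

/-- The radius r is signed and may vanish: for r ≠ 0 the angle is the argument of the unit complex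
number (x + iy)/r, and for r = 0 any angle works. -/
theorem exists_polar_coordinates {x y r : ℝ} (h : x ^ 2 + y ^ 2 = r ^ 2) :
    ∃ θ : ℝ, x = r * Real.cos θ ∧ y = r * Real.sin θ := by
  rcases eq_or_ne r 0 with rfl | hr
  · refine ⟨0, ?_, ?_⟩ <;> nlinarith [sq_nonneg x, sq_nonneg y]
  · have hn : ‖(⟨x / r, y / r⟩ : ℂ)‖ = 1 := by
      rw [← sq_eq_sq₀ (norm_nonneg _) zero_le_one, Complex.sq_norm, Complex.normSq_mk]
      field_simp
      linarith
    have h0 : (⟨x / r, y / r⟩ : ℂ) ≠ 0 := by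
      intro h0
      simp [h0] at hn
    refine ⟨Complex.arg ⟨x / r, y / r⟩, ?_, ?_⟩
    · rw [Complex.cos_arg h0, hn]
      field_simp
    · rw [Complex.sin_arg, hn]
      field_simp

theorem teProj_surjective (μ : ℝ) (hμ : 0 < μ) : Function.Surjective (teProj μ hμ) := by
  intro p
  have hp : p.1 0 ^ 2 + p.1 1 ^ 2 = ((1 - μ ^ 2) / (2 * μ) * Real.sinh (μ * p.1 2)) ^ 2 := by
    rw [mul_pow]
    exact p.2
  obtain ⟨θ, h0, h1⟩ := exists_polar_coordinates hp
  refine ⟨(p.1 2, (θ : Real.Angle)), Subtype.ext ?_⟩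
  rw [teProj_coe]
  ext i
  fin_cases i
  · exact h0.symm
  · exact h1.symm
  · rfl

theorem fTE_eq_fTETilde_teProj (μ : ℝ) (hμ : 0 < μ) (q : ℝ × Real.Angle) :
    fTE μ hμ q = fTETilde μ hμ (teProj μ hμ q) := by
  obtain ⟨s, θ⟩ := q
  induction θ using Real.Angle.induction_on with
  | _ θ =>
    apply Subtype.ext
    simp only [fTETilde, teProj_coe, fTE_coe]
    simp

theorem range_fTE (μ : ℝ) (hμ : 0 < μ) : range (fTE μ hμ) = range (fTETilde μ hμ) := by
  rw [show fTE μ hμ = fTETilde μ hμ ∘ teProj μ hμ from funext (fTE_eq_fTETilde_teProj μ hμ),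
    (teProj_surjective μ hμ).range_comp]

theorem surfaceTE_eq_zero_iff {μ : ℝ} (p : surfaceTE μ) :
    (p : Fin 3 → ℝ) = 0 ↔ p.1 2 = 0 := by
  refine ⟨fun h => by simp [h], fun h => ?_⟩
  have hp : p.1 0 ^ 2 + p.1 1 ^ 2 = _ := p.2
  rw [h, mul_zero, Real.sinh_zero] at hp
  ext i
  fin_cases i
  · change p.1 0 = 0
    nlinarith [sq_nonneg (p.1 0), sq_nonneg (p.1 1)]
  · change p.1 1 = 0
    nlinarith [sq_nonneg (p.1 0), sq_nonneg (p.1 1)]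
  · exact h

/-! ### Properness. -/

theorem continuous_fTETilde (μ : ℝ) (hμ : 0 < μ) : Continuous (fTETilde μ hμ) := by
  refine Continuous.subtype_mk (continuous_pi fun i => ?_) _
  have h (i : Fin 3) : Continuous fun p : surfaceTE μ => p.1 i :=
    (continuous_apply i).comp continuous_subtype_val
  fin_cases i
  · exact (contDiff_teX0 μ (n := 0)).continuous.comp (h 2)
  · exact h 0
  · exact h 1
  · exact (contDiff_teX3 μ (n := 0)).continuous.comp (h 2)

theorem isClosed_deSitter : IsClosed deSitter := by
  refine isClosed_eq ?_ continuous_const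
  unfold lorentz
  fun_prop

instance : LocallyCompactSpace deSitter := isClosed_deSitter.locallyCompactSpace

theorem isProperMap_fTETilde (μ : ℝ) (hμ : 0 < μ) (hμ1 : μ ≠ 1) :
    IsProperMap (fTETilde μ hμ) := by
  have hc := te_const_ne_zero hμ hμ1
  rw [isProperMap_iff_isCompact_preimage]
  refine ⟨continuous_fTETilde μ hμ, fun K hK => ?_⟩
  have hK' : IsCompact (Subtype.val '' K) := hK.image continuous_subtype_val
  obtain ⟨R, hR⟩ := hK'.isBounded.exists_norm_le
  -- On the preimage |ξ|, |η| ≤ R, so c² sinh² μs = ξ² + η² ≤ 2R²; solving for s gives T.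
  set T : ℝ := Real.arsinh (Real.sqrt (2 * R ^ 2 / ((1 - μ ^ 2) / (2 * μ)) ^ 2)) / μ
  rw [Subtype.isCompact_iff]
  have hcl : IsClosed (Subtype.val '' (fTETilde μ hμ ⁻¹' K)) :=
    (isClosed_surfaceTE μ).isClosedMap_subtype_val _
      (hK.isClosed.preimage (continuous_fTETilde μ hμ))
  refine (isCompact_Icc (a := ![-R, -R, -T]) (b := ![R, R, T])).of_isClosed_subset hcl ?_
  rintro _ ⟨p, hp, rfl⟩
  have hn := hR _ ⟨_, hp, rfl⟩
  have hb (i : Fin 4) := abs_le.1 ((norm_le_pi_norm _ i).trans hn)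
  have h1 : -R ≤ p.1 0 ∧ p.1 0 ≤ R := hb 1
  have h2 : -R ≤ p.1 1 ∧ p.1 1 ≤ R := hb 2
  have hs : -T ≤ p.1 2 ∧ p.1 2 ≤ T := by
    have hp' : p.1 0 ^ 2 + p.1 1 ^ 2 = _ := p.2
    have h3 : Real.sinh (μ * p.1 2) ^ 2 ≤ 2 * R ^ 2 / ((1 - μ ^ 2) / (2 * μ)) ^ 2 := by
      rw [le_div_iff₀ (by positivity)]
      nlinarith [sq_le_sq' h1.1 h1.2, sq_le_sq' h2.1 h2.2]
    have h4 := abs_le.1 (Real.abs_le_sqrt h3)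
    constructor
    · rw [← neg_div, div_le_iff₀ hμ, ← Real.sinh_le_sinh, Real.sinh_neg, Real.sinh_arsinh,
        mul_comm (p.1 2)]
      exact h4.1
    · rw [le_div_iff₀ hμ, ← Real.sinh_le_sinh, Real.sinh_arsinh, mul_comm (p.1 2)]
      exact h4.2
  constructor
  · intro i
    fin_cases i
    exacts [h1.1, h2.1, hs.1]
  · intro i
    fin_cases i
    exacts [h1.2, h2.2, hs.2]

/-! ### Even analytic functions and analytic completeness of the image. -/

open Filter Topology in
/-- An even analytic function is locally an analytic function of the square of the variable. -/
theorem AnalyticAt.exists_eq_comp_sq_of_even {F : ℝ → ℝ} (hF : AnalyticAt ℝ F 0)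
    (he : ∀ x, F (-x) = F x) :
    ∃ H : ℝ → ℝ, AnalyticAt ℝ H 0 ∧ ∀ᶠ x in 𝓝 0, F x = H (x ^ 2) := by
  obtain ⟨p, hp⟩ := hF
  rw [hasFPowerSeriesAt_iff] at hp
  simp only [zero_add, smul_eq_mul] at hp
  have hneg : Tendsto (fun x : ℝ => -x) (𝓝 0) (𝓝 0) := by
    simpa using (continuous_neg (G := ℝ)).tendsto 0
  have hsum : ∀ᶠ x in 𝓝 (0 : ℝ), HasSum (fun n => (x ^ 2) ^ n * p.coeff (2 * n)) (F x) := by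
    filter_upwards [hp, hneg.eventually hp] with x h1 h2
    rw [he] at h2
    -- Averaging the expansions at x and -x cancels the odd coefficients.
    have h3 := (h1.add h2).mul_left (1 / 2)
    have hinj : Function.Injective fun n : ℕ => 2 * n := fun a b h => by simpa using h
    rw [← hinj.hasSum_iff] at h3
    · rw [← two_mul, one_div, inv_mul_cancel_left₀ two_ne_zero] at h3
      refine Eq.mp (congrArg (fun g => HasSum g (F x)) (funext fun n => ?_)) h3
      simp only [Function.comp_apply, pow_mul, neg_sq]
      ring
    · intro n hn
      have hodd : Odd n := by
        rw [← Nat.not_even_iff_odd]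
        rintro ⟨k, rfl⟩
        exact hn ⟨k, by simp [two_mul]⟩
      rw [hodd.neg_pow]
      ring
  refine ⟨fun u => ∑' n, u ^ n * p.coeff (2 * n), ?_, ?_⟩
  · refine ⟨FormalMultilinearSeries.ofScalars ℝ fun n => p.coeff (2 * n), ?_⟩
    rw [hasFPowerSeriesAt_iff]
    -- The series in u must also converge for u < 0, where u is not a square. Absolute convergence
    -- at x = √|u| gives it.
    have hs : Tendsto (fun u : ℝ => Real.sqrt |u|) (𝓝 0) (𝓝 0) := by
      simpa using (continuous_abs.sqrt).tendsto (0 : ℝ)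
    filter_upwards [hs.eventually hsum] with u hu
    simp only [FormalMultilinearSeries.coeff_ofScalars, zero_add, smul_eq_mul]
    refine Summable.hasSum ?_
    rw [← summable_abs_iff]
    refine (summable_abs_iff.2 hu.summable).congr fun n => ?_
    rw [Real.sq_sqrt (abs_nonneg u), abs_mul, abs_mul, abs_pow, abs_pow, abs_abs]
  · filter_upwards [hsum] with x hx
    exact hx.tsum_eq.symm

open Filter Topology in
-- Where r vanishes the square root is not analytic, but an even F is locally an analytic function
-- of the square, and the root disappears. Elsewhere the square root itself is analytic.
theorem AnalyticAt.comp_sqrt_of_even {F r : ℝ → ℝ} {t : ℝ} (hF : ∀ x, AnalyticAt ℝ F x)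
    (he : ∀ x, F (-x) = F x) (hr : AnalyticAt ℝ r t) (h0 : ∀ x, 0 ≤ r x) :
    AnalyticAt ℝ (fun x => F (Real.sqrt (r x))) t := by
  rcases eq_or_ne (r t) 0 with ht | ht
  · obtain ⟨H, hH, hFH⟩ := (hF 0).exists_eq_comp_sq_of_even he
    rw [← ht] at hH
    refine (hH.comp hr).congr ?_
    have hs : Tendsto (fun x => Real.sqrt (r x)) (𝓝 t) (𝓝 0) := by
      simpa [ht] using hr.continuousAt.sqrt.tendsto
    filter_upwards [hs.eventually hFH] with x hx
    rw [hx, Real.sq_sqrt (h0 x)]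
    rfl
  · have hs : AnalyticAt ℝ (fun x => Real.sqrt (r x)) t :=
      (((hr.contDiffAt (n := ⊤)).sqrt ht).analyticAt)
    exact (hF _).comp hs

open Filter Topology in
-- The identity theorem applies on the open interval; continuity carries the zero to the endpoints,
-- where two-sided analyticity is not available.
theorem eqOn_zero_Icc_of_analyticOnNhd_Ioo {h : ℝ → ℝ} {ε : ℝ} (hε : 0 < ε)
    (hc : ContinuousOn h (Icc 0 1)) (ha : AnalyticOnNhd ℝ h (Ioo 0 1))
    (h0 : ∀ t ∈ Ioo 0 ε, h t = 0) : ∀ t ∈ Icc (0 : ℝ) 1, h t = 0 := by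
  have hm : 0 < min ε 1 := lt_min hε one_pos
  have hm1 := min_le_left ε 1
  have hm2 := min_le_right ε 1
  have hz : EqOn h 0 (Ioo 0 1) := by
    refine ha.eqOn_zero_of_preconnected_of_eventuallyEq_zero isPreconnected_Ioo
      (z₀ := min ε 1 / 2) ⟨by linarith, by linarith⟩ ?_
    filter_upwards [Ioo_mem_nhds (a := 0) (b := min ε 1) (x := min ε 1 / 2) (by linarith)
      (by linarith)] with t ht
    exact h0 t ⟨ht.1, ht.2.trans_le hm1⟩
  have hcl : Icc (0 : ℝ) 1 ⊆ closure (Ioo 0 1) := by rw [closure_Ioo zero_ne_one]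
  exact hz.of_subset_closure hc continuousOn_const Ioo_subset_Icc_self hcl

/-- The coordinate `x₃` of the catenoid as an even function of its signed radius. -/
noncomputable def teRadial (μ w : ℝ) : ℝ :=
  teX3 μ (Real.arsinh (w / ((1 - μ ^ 2) / (2 * μ))) / μ)

theorem teX0_neg (μ s : ℝ) : teX0 μ (-s) = -teX0 μ s := by
  simp only [teX0, mul_neg, Real.sinh_neg, Real.cosh_neg]
  ring

theorem teX3_neg (μ s : ℝ) : teX3 μ (-s) = teX3 μ s := by
  simp only [teX3, mul_neg, Real.sinh_neg, Real.cosh_neg]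
  ring

theorem teRadial_neg (μ w : ℝ) : teRadial μ (-w) = teRadial μ w := by
  simp only [teRadial, neg_div, Real.arsinh_neg, teX3_neg]

theorem contDiff_arsinh_div_div (μ c : ℝ) {n : WithTop ℕ∞} :
    ContDiff ℝ n fun w : ℝ => Real.arsinh (w / c) / μ :=
  (Real.contDiff_arsinh.comp (contDiff_id.div_const _)).div_const _

theorem contDiff_teRadial (μ : ℝ) {n : WithTop ℕ∞} : ContDiff ℝ n (teRadial μ) :=
  (contDiff_teX3 μ).comp (contDiff_arsinh_div_div μ _)

/-- Given x₁ and x₂, the equation fixes x₃, and the de Sitter equation then fixes x₀ up to sign.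
Both signs occur on the surface, since s ↦ -s reverses x₀ and preserves x₃ and the cone equation. -/
theorem mem_range_fTETilde_iff {μ : ℝ} (hμ : 0 < μ) (hμ1 : μ ≠ 1) (y : deSitter) :
    y ∈ range (fTETilde μ hμ) ↔ y.1 3 = teRadial μ (Real.sqrt (y.1 1 ^ 2 + y.1 2 ^ 2)) := by
  have hc := te_const_ne_zero hμ hμ1
  constructor
  · rintro ⟨p, rfl⟩
    have hp : p.1 0 ^ 2 + p.1 1 ^ 2 = _ := p.2
    change teX3 μ (p.1 2) = teRadial μ (Real.sqrt (p.1 0 ^ 2 + p.1 1 ^ 2))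
    have h2 : teRadial μ ((1 - μ ^ 2) / (2 * μ) * Real.sinh (μ * p.1 2)) = teX3 μ (p.1 2) := by
      rw [teRadial, mul_div_cancel_left₀ _ hc, Real.arsinh_sinh, mul_div_cancel_left₀ _ hμ.ne']
    -- The root is the absolute value of the signed radius; evenness of `teRadial` absorbs the sign.
    rw [hp, ← mul_pow, Real.sqrt_sq_eq_abs, ← h2]
    rcases abs_choice ((1 - μ ^ 2) / (2 * μ) * Real.sinh (μ * p.1 2)) with h | h
    · rw [h]
    · rw [h, teRadial_neg]
  · intro h
    set w := Real.sqrt (y.1 1 ^ 2 + y.1 2 ^ 2) with hw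
    have hw2 : w ^ 2 = y.1 1 ^ 2 + y.1 2 ^ 2 := Real.sq_sqrt (by positivity)
    set s := Real.arsinh (w / ((1 - μ ^ 2) / (2 * μ))) / μ with hs
    have hsinh : (1 - μ ^ 2) / (2 * μ) * Real.sinh (μ * s) = w := by
      rw [hs, mul_div_cancel₀ _ hμ.ne', Real.sinh_arsinh, mul_div_cancel₀ _ hc]
    have hid := te_identity hμ s
    rw [← mul_pow, hsinh, hw2] at hid
    have hy : -(y.1 0 * y.1 0) + y.1 1 * y.1 1 + y.1 2 * y.1 2 + y.1 3 * y.1 3 = 1 := y.2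
    have h3 : y.1 3 = teX3 μ s := h
    rw [h3] at hy
    have h0 : y.1 0 ^ 2 = teX0 μ s ^ 2 := by linarith
    have hmem (σ : ℝ) (hσ : (Real.sinh (μ * σ)) ^ 2 = Real.sinh (μ * s) ^ 2)
        (hσ0 : teX0 μ σ = y.1 0) (hσ3 : teX3 μ σ = y.1 3) : y ∈ range (fTETilde μ hμ) := by
      refine ⟨⟨![y.1 1, y.1 2, σ], ?_⟩, ?_⟩
      · change y.1 1 ^ 2 + y.1 2 ^ 2 = _ * Real.sinh (μ * σ) ^ 2
        rw [hσ, ← mul_pow, hsinh, hw2]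
      · apply Subtype.ext
        ext i
        fin_cases i
        exacts [hσ0, rfl, rfl, hσ3]
    rcases sq_eq_sq_iff_eq_or_eq_neg.1 h0 with h0 | h0
    · exact hmem s rfl h0.symm h3.symm
    · refine hmem (-s) ?_ ?_ ?_
      · rw [mul_neg, Real.sinh_neg, neg_sq]
      · rw [teX0_neg, h0]
      · rw [teX3_neg, h3]

theorem isAnalyticallyComplete_range_fTETilde {μ : ℝ} (hμ : 0 < μ) (hμ1 : μ ≠ 1) :
    IsAnalyticallyComplete (range (fTETilde μ hμ)) := by
  refine ⟨?_, ?_⟩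
  · rw [← range_fTE]
    exact range_nonempty _
  rintro Γ hΓ ⟨ε, hε, hS⟩
  have hcoord (i : Fin 4) : AnalyticOn ℝ (fun t => (Γ t : Fin 4 → ℝ) i) (Icc 0 1) := fun t ht =>
    (ContinuousLinearMap.proj (R := ℝ) (φ := fun _ : Fin 4 => ℝ) i).analyticAt _
      |>.comp_analyticWithinAt (hΓ t ht)
  have hcont (i : Fin 4) : ContinuousOn (fun t => (Γ t : Fin 4 → ℝ) i) (Icc 0 1) :=
    (hcoord i).continuousOn
  have hat (i : Fin 4) (t : ℝ) (ht : t ∈ Ioo (0 : ℝ) 1) :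
      AnalyticAt ℝ (fun t => (Γ t : Fin 4 → ℝ) i) t :=
    by
    -- Analyticity within [0,1] means agreement there with an analytic germ; at an interior point
    -- this is full agreement near t.
    obtain ⟨g, -, hg, hga⟩ := (hcoord i t (Ioo_subset_Icc_self ht)).exists_analyticAt
    refine hga.congr ?_
    filter_upwards [Icc_mem_nhds ht.1 ht.2] with x hx using (hg (mem_insert_of_mem _ hx)).symm
  have key := eqOn_zero_Icc_of_analyticOnNhd_Ioo (ε := ε)
    (h := fun t => (Γ t : Fin 4 → ℝ) 3 -
      teRadial μ (Real.sqrt ((Γ t : Fin 4 → ℝ) 1 ^ 2 + (Γ t : Fin 4 → ℝ) 2 ^ 2))) hε.1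
    ((hcont 3).sub ((contDiff_teRadial μ (n := 0)).continuous.comp_continuousOn
      (((hcont 1).pow 2).add ((hcont 2).pow 2)).sqrt))
    (fun t ht => (hat 3 t ht).sub (AnalyticAt.comp_sqrt_of_even
      (fun x => (contDiff_teRadial μ).analyticOnNhd_of_omega univ x trivial) (teRadial_neg μ)
      (((hat 1 t ht).pow 2).add ((hat 2 t ht).pow 2))
      (fun x => add_nonneg (sq_nonneg _) (sq_nonneg _))))
    (fun t ht => by
      rw [sub_eq_zero]
      exact (mem_range_fTETilde_iff hμ hμ1 _).1 (hS t ⟨ht.1.le, ht.2⟩))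
  intro t ht
  rw [mem_range_fTETilde_iff hμ hμ1]
  exact sub_eq_zero.1 (key t ht)

/-! ## Points of the double cone under analytic coordinate changes -/

theorem mem_doubleCone_two {x : Fin 3 → ℝ} :
    x ∈ doubleCone 2 ↔ x 0 ^ 2 + x 1 ^ 2 = x 2 ^ 2 := by
  rw [doubleCone, mem_ofPred_eq, Fin.sum_univ_two]
  rfl

theorem smul_mem_doubleCone_two {x : Fin 3 → ℝ} (hx : x ∈ doubleCone 2) (t : ℝ) :
    t • x ∈ doubleCone 2 := by
  rw [mem_doubleCone_two] at hx ⊢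
  simp only [Pi.smul_apply, smul_eq_mul, mul_pow]
  rw [← mul_add, hx]

/-- The double cone spans `ℝ³`. -/
theorem ContinuousLinearMap.eq_of_eqOn_doubleCone {E : Type*} [NormedAddCommGroup E]
    [NormedSpace ℝ E] {L M : (Fin 3 → ℝ) →L[ℝ] E} (h : EqOn L M (doubleCone 2)) : L = M := by
  ext1 v
  have hv : v = ((v 0 + v 2 - v 1) / 2) • ![1, 0, 1] + v 1 • ![0, 1, 1]
      + ((v 2 - v 1 - v 0) / 2) • ![-1, 0, 1] := by
    ext i
    fin_cases i <;> simp <;> ring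
  rw [hv]
  simp only [map_add, map_smul]
  rw [h (x := ![1, 0, 1]), h (x := ![0, 1, 1]), h (x := ![-1, 0, 1])] <;>
    simp [mem_doubleCone_two]

open Filter Topology in
-- The hypotheses on G and H hold only on the cone, but its rays through 0 determine derivatives at
-- 0. They give H'G' = 1, and, since G stays on the cone, they show that the image of G' is killed
-- by the differential of the cone equation at q = G 0. As G' is onto, that differential is zero, so
-- q = 0.
theorem eq_zero_of_doubleCone_leftInverse {G H : (Fin 3 → ℝ) → (Fin 3 → ℝ)}
    (hG : DifferentiableAt ℝ G 0) (hH : DifferentiableAt ℝ H (G 0))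
    (h : ∀ᶠ x in 𝓝 0, x ∈ doubleCone 2 → G x ∈ doubleCone 2 ∧ H (G x) = x) : G 0 = 0 := by
  set q := G 0 with hq
  set G' := fderiv ℝ G 0
  set H' := fderiv ℝ H q
  have hray (v : Fin 3 → ℝ) (hv : v ∈ doubleCone 2) :
      HasDerivAt (fun t : ℝ => G (t • v)) (G' v) 0 ∧
        ∀ᶠ t : ℝ in 𝓝 0, G (t • v) ∈ doubleCone 2 ∧ H (G (t • v)) = t • v := by
    have hd : HasDerivAt (fun t : ℝ => t • v) v 0 := by
      simpa using (hasDerivAt_id (0 : ℝ)).smul_const v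
    have hG0 : HasFDerivAt G G' ((0 : ℝ) • v) := by
      rw [zero_smul]
      exact hG.hasFDerivAt
    refine ⟨hG0.comp_hasDerivAt (0 : ℝ) hd, ?_⟩
    have ht : Tendsto (fun t : ℝ => t • v) (𝓝 0) (𝓝 0) := by
      simpa using hd.continuousAt.tendsto
    filter_upwards [ht.eventually h] with t h1 using h1 (smul_mem_doubleCone_two hv t)
  have hleft : H'.comp G' = ContinuousLinearMap.id ℝ (Fin 3 → ℝ) := by
    refine ContinuousLinearMap.eq_of_eqOn_doubleCone fun v hv => ?_
    obtain ⟨h1, h2⟩ := hray v hv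
    have hH0 : HasFDerivAt H H' (G ((0 : ℝ) • v)) := by
      rw [zero_smul]
      exact hH.hasFDerivAt
    have h3 := hH0.comp_hasDerivAt (0 : ℝ) h1
    have h4 : HasDerivAt (fun t : ℝ => t • v) v 0 := by
      simpa using (hasDerivAt_id (0 : ℝ)).smul_const v
    exact h3.unique (h4.congr_of_eventuallyEq (h2.mono fun t ht => ht.2))
  -- In finite dimension a left inverse is also a right inverse.
  have hright : ∀ w, G' (H' w) = w := by
    have h1 : H'.toLinearMap * G'.toLinearMap = 1 :=
      LinearMap.ext fun v => congrArg (fun L => L v) hleft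
    rw [mul_eq_one_comm] at h1
    exact fun w => congrArg (fun L => L w) h1
  -- Half the differential of x₀² + x₁² - x₂² at q.
  set Q : (Fin 3 → ℝ) →L[ℝ] ℝ :=
    q 0 • ContinuousLinearMap.proj 0 + q 1 • ContinuousLinearMap.proj 1
      - q 2 • ContinuousLinearMap.proj 2 with hQ
  have hzero : Q.comp G' = 0 := by
    refine ContinuousLinearMap.eq_of_eqOn_doubleCone fun v hv => ?_
    obtain ⟨h1, h2⟩ := hray v hv
    have hi (i : Fin 3) := (hasDerivAt_pi.1 h1) i
    have h3 := (((hi 0).pow 2).add ((hi 1).pow 2)).sub ((hi 2).pow 2)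
    have h4 := h3.unique ((hasDerivAt_const (0 : ℝ) (0 : ℝ)).congr_of_eventuallyEq
      (h2.mono fun t ht => by
        have := mem_doubleCone_two.1 ht.1
        simpa [sub_eq_zero] using this))
    simp only [zero_smul, ← hq] at h4
    simp only [hQ, ContinuousLinearMap.comp_apply, sub_apply,
      add_apply, smul_apply,
      ContinuousLinearMap.proj_apply, smul_eq_mul, zero_apply]
    norm_num at h4
    linarith
  have hQ0 (w : Fin 3 → ℝ) : Q w = 0 := by
    rw [← hright w]
    exact congrArg (fun L => L (H' w)) hzero
  have h0 := hQ0 ![1, 0, 0]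
  have h1 := hQ0 ![0, 1, 0]
  have h2 := hQ0 ![0, 0, 1]
  simp [hQ] at h0 h1 h2
  ext i
  fin_cases i
  exacts [h0, h1, h2]

theorem teHomeomorph_isChart (μ : ℝ) (hμ : 0 < μ) (hμ1 : μ ≠ 1) :
    (surfaceTE.dcStructure μ hμ hμ1).IsChart
      (teHomeomorph μ hμ hμ1).toOpenPartialHomeomorph :=
  fun φ hφ => ⟨(surfaceTE.dcStructure μ hμ hμ1).analytic_transition _ rfl φ hφ,
    (surfaceTE.dcStructure μ hμ hμ1).analytic_transition φ hφ _ rfl⟩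

theorem teHomeomorph_eq_zero_iff {μ : ℝ} (hμ : 0 < μ) (hμ1 : μ ≠ 1) (p : surfaceTE μ) :
    (teHomeomorph μ hμ hμ1 p : Fin 3 → ℝ) = 0 ↔ (p : Fin 3 → ℝ) = 0 := by
  have hc := te_const_ne_zero hμ hμ1
  constructor
  · intro h
    rw [surfaceTE_eq_zero_iff]
    have h2 : (1 - μ ^ 2) / (2 * μ) * Real.sinh (μ * p.1 2) = 0 := congrFun h 2
    rcases mul_eq_zero.1 h2 with h2 | h2
    · exact absurd h2 hc
    · exact (mul_eq_zero.1 (Real.sinh_eq_zero.1 h2)).resolve_left hμ.ne'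
  · intro h
    have h' (i : Fin 3) : p.1 i = 0 := congrFun h i
    ext i
    fin_cases i
    · exact h' 0
    · exact h' 1
    · change (1 - μ ^ 2) / (2 * μ) * Real.sinh (μ * p.1 2) = 0
      rw [h' 2, mul_zero, Real.sinh_zero, mul_zero]

theorem isDCPoint_surfaceTE_iff {μ : ℝ} (hμ : 0 < μ) (hμ1 : μ ≠ 1) (p : surfaceTE μ) :
    (surfaceTE.dcStructure μ hμ hμ1).IsDCPoint p ↔ (p : Fin 3 → ℝ) = 0 := by
  constructor
  · rintro ⟨ψ, hψ, hp, h0⟩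
    -- G and H are the ambient extensions of the transitions from ψ to the global chart and back.
    obtain ⟨⟨Ω, G, hΩ, hG, hΩs, hGe⟩, ⟨Ω', H, hΩ', hH, hΩs', hHe⟩⟩ := hψ _ rfl
    set z : doubleCone 2 := ψ p with hz
    have hzt : z ∈ ψ.target := ψ.map_source hp
    have hsrc : ∀ a, a ∈ ψ.target → a ∈ Subtype.val ⁻¹' Ω := fun a ha => by
      rw [hΩs]
      simpa using ha
    have hsrc' : ∀ a, a ∈ Subtype.val ⁻¹' Ω → a ∈ ψ.target := fun a ha => by
      rw [hΩs] at ha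
      simpa using ha
    have hGa (a : doubleCone 2) (ha : a ∈ ψ.target) :
        G a = teHomeomorph μ hμ hμ1 (ψ.symm a) :=
      hGe a (by rw [← hΩs]; exact hsrc a ha)
    have htgt (a : doubleCone 2) (ha : a ∈ ψ.target) :
        teHomeomorph μ hμ hμ1 (ψ.symm a) ∈ Subtype.val ⁻¹' Ω' := by
      rw [hΩs']
      simpa using ψ.map_target ha
    have hHa (a : doubleCone 2) (ha : a ∈ ψ.target) : H (G a) = a := by
      have h1 := htgt a ha
      rw [hΩs'] at h1
      rw [hGa a ha, hHe _ h1]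
      simp [ψ.right_inv ha]
    have hGz := hGa z hzt
    have h0Ω : (0 : Fin 3 → ℝ) ∈ Ω := by
      have := hsrc z hzt
      rwa [mem_preimage, h0] at this
    have hG0 : G 0 = teHomeomorph μ hμ hμ1 p := by
      rw [← ψ.left_inv hp, ← hz, ← hGz, h0]
    rw [← teHomeomorph_eq_zero_iff hμ hμ1, ← hG0]
    refine eq_zero_of_doubleCone_leftInverse (H := H) (hG 0 h0Ω).differentiableAt ?_ ?_
    · refine (hH _ ?_).differentiableAt
      have := htgt z hzt
      rw [mem_preimage, ← hGz, h0] at this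
      exact this
    · filter_upwards [hΩ.mem_nhds h0Ω] with x hx hxc
      have ha := hsrc' ⟨x, hxc⟩ hx
      refine ⟨?_, hHa ⟨x, hxc⟩ ha⟩
      rw [hGa ⟨x, hxc⟩ ha]
      exact Subtype.property _
  · intro h
    exact ⟨_, teHomeomorph_isChart μ hμ hμ1, mem_univ _,
      (teHomeomorph_eq_zero_iff hμ hμ1 p).2 h⟩

/-! ## Local analytic coordinates -/

/-- Produces a chart of N from ambient analytic maps K and J that are mutually inverse between N ∩ O
and V. -/
theorem exists_isAnalyticDiffeo {k n : ℕ} {N : Set (Fin k → ℝ)} (y₀ : N)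
    {O : Set (Fin k → ℝ)} {V : Set (Fin n → ℝ)} {K : (Fin k → ℝ) → (Fin n → ℝ)}
    {J : (Fin n → ℝ) → (Fin k → ℝ)} (hO : IsOpen O) (hV : IsOpen V)
    (hK : AnalyticOnNhd ℝ K O) (hJ : AnalyticOnNhd ℝ J V)
    (hKV : ∀ y ∈ N, y ∈ O → K y ∈ V) (hJN : ∀ v ∈ V, J v ∈ N) (hJO : ∀ v ∈ V, J v ∈ O)
    (hJK : ∀ y ∈ N, y ∈ O → J (K y) = y) (hKJ : ∀ v ∈ V, K (J v) = v) :
    ∃ Φ : OpenPartialHomeomorph N (Fin n → ℝ), IsAnalyticDiffeo Φ ∧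
      Φ.source = Subtype.val ⁻¹' O ∧ ∀ y : N, Φ y = K y := by
  classical
  have hcoe (v : Fin n → ℝ) (hv : v ∈ V) :
      ((if h : J v ∈ N then ⟨J v, h⟩ else y₀ : N) : Fin k → ℝ) = J v := by
    rw [dif_pos (hJN v hv)]
  refine ⟨
    { toFun := fun y => K y
      -- `y₀` is only a default value, taken where J leaves N and hence outside V.
      invFun := fun v => if h : J v ∈ N then ⟨J v, h⟩ else y₀
      source := Subtype.val ⁻¹' O
      target := V
      map_source' := fun y hy => hKV y y.2 hy
      map_target' := fun v hv => by
        rw [mem_preimage, hcoe v hv]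
        exact hJO v hv
      left_inv' := fun y hy => Subtype.ext <| by
        rw [hcoe _ (hKV y y.2 hy), hJK y y.2 hy]
      right_inv' := fun v hv => by
        rw [hcoe v hv, hKJ v hv]
      open_source := hO.preimage continuous_subtype_val
      open_target := hV
      continuousOn_toFun := hK.continuousOn.comp continuous_subtype_val.continuousOn
        fun y hy => hy
      continuousOn_invFun := by
        rw [Topology.IsInducing.subtypeVal.continuousOn_iff]
        exact hJ.continuousOn.congr hcoe }, ⟨⟨O, K, hO, hK, rfl, fun _ _ => rfl⟩, ?_⟩, rfl,
      fun _ => rfl⟩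
  exact hJ.congr hV fun v hv => (hcoe v hv).symm

/-- Invertibility of the derivative is assumed only at a. Restricting the local inverse to the open
set where the derivative is invertible makes the inverse analytic on the whole target. -/
theorem ContDiff.exists_openPartialHomeomorph_analytic_symm {E : Type*} [NormedAddCommGroup E]
    [NormedSpace ℝ E] [CompleteSpace E] {F : E → E} (hF : ContDiff ℝ ⊤ F) {a : E}
    {F' : E ≃L[ℝ] E} (ha : HasFDerivAt F (F' : E →L[ℝ] E) a) :
    ∃ e : OpenPartialHomeomorph E E, a ∈ e.source ∧ ⇑e = F ∧ AnalyticOnNhd ℝ e.symm e.target := by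
  set e := hF.contDiffAt.toOpenPartialHomeomorph F ha (by simp)
  have hs : IsOpen {x | fderiv ℝ F x ∈ range ((↑) : (E ≃L[ℝ] E) → E →L[ℝ] E)} :=
    ContinuousLinearEquiv.isOpen.preimage (hF.continuous_fderiv (by simp))
  refine ⟨e.restrOpen _ hs, ⟨hF.contDiffAt.mem_toOpenPartialHomeomorph_source ha (by simp),
    ⟨F', ha.fderiv.symm⟩⟩, rfl, fun b hb => ?_⟩
  have hb' := (e.restrOpen _ hs).map_target hb
  obtain ⟨L, hL⟩ := hb'.2
  refine (e.contDiffAt_symm (n := ⊤) ?_ (f₀' := L) ?_ hF.contDiffAt).analyticAt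
  · exact hb.1
  · rw [hL]
    exact (hF.differentiable (by simp) _).hasFDerivAt

/-- An analytic map of the form `(a₀, a₁, p (a₂))` on the double cone extends to a local analytic
diffeomorphism of `ℝ³`, provided that `p` is immersive at the vertex. -/
theorem exists_openPartialHomeomorph_eqOn_doubleCone {p : ℝ → ℝ} (hp : ContDiff ℝ ⊤ p)
    (a : Fin 3 → ℝ) (h0 : deriv p 0 ≠ 0) :
    ∃ e : OpenPartialHomeomorph (Fin 3 → ℝ) (Fin 3 → ℝ), a ∈ e.source ∧ ContDiff ℝ ⊤ e ∧
      AnalyticOnNhd ℝ e.symm e.target ∧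
      ∀ x ∈ doubleCone 2, e x = ![x 0, x 1, p (x 2)] := by
  -- This quantity will be the last diagonal entry of the derivative of F at a. If a₂ = 0 it is
  -- p'(0) for every k; otherwise k is chosen to make it 1.
  obtain ⟨k, hk⟩ : ∃ k : ℝ, deriv p (a 2) - 2 * k * a 2 ≠ 0 := by
    rcases eq_or_ne (a 2) 0 with ha | ha
    · exact ⟨0, by simpa [ha] using h0⟩
    · refine ⟨(deriv p (a 2) - 1) / (2 * a 2), ?_⟩
      field_simp
      simp
  set F : (Fin 3 → ℝ) → (Fin 3 → ℝ) := fun x =>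
    ![x 0, x 1, p (x 2) + k * (x 0 ^ 2 + x 1 ^ 2 - x 2 ^ 2)] with hF
  have hcoord (i : Fin 3) : ContDiff ℝ ⊤ fun x : Fin 3 → ℝ => x i := contDiff_apply ℝ ℝ i
  have hFs : ContDiff ℝ ⊤ F := by
    rw [contDiff_pi]
    intro i
    fin_cases i
    · exact hcoord 0
    · exact hcoord 1
    · exact (hp.comp (hcoord 2)).add (contDiff_const.mul
        ((((hcoord 0).pow 2).add ((hcoord 1).pow 2)).sub ((hcoord 2).pow 2)))
  set π : Fin 3 → ((Fin 3 → ℝ) →L[ℝ] ℝ) := fun i => ContinuousLinearMap.proj i with hπ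
  set L : (Fin 3 → ℝ) →L[ℝ] (Fin 3 → ℝ) := ContinuousLinearMap.pi
    ![π 0, π 1, (2 * k * a 0) • π 0 + (2 * k * a 1) • π 1
      + (deriv p (a 2) - 2 * k * a 2) • π 2] with hL
  have hFL : HasFDerivAt F L a := by
    have hc (i : Fin 3) : HasFDerivAt (fun x : Fin 3 → ℝ => x i) (π i) a := hasFDerivAt_apply i a
    rw [hasFDerivAt_pi']
    intro i
    fin_cases i
    · exact hc 0
    · exact hc 1
    · have h1 := ((hp.differentiable (by simp) (a 2)).hasDerivAt.comp_hasFDerivAt a (hc 2)).add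
        (((((hc 0).pow 2).add ((hc 1).pow 2)).sub ((hc 2).pow 2)).const_mul k)
      refine h1.congr_fderiv ?_
      ext1 v
      simp [hL, hπ]
      ring
  have hinj : Function.Injective L := by
    rw [injective_iff_map_eq_zero]
    intro v hv
    have h0 : v 0 = 0 := congrFun hv 0
    have h1 : v 1 = 0 := congrFun hv 1
    have h2 : 2 * k * a 0 * v 0 + 2 * k * a 1 * v 1 + (deriv p (a 2) - 2 * k * a 2) * v 2 = 0 :=
      congrFun hv 2
    rw [h0, h1, mul_zero, mul_zero, add_zero, zero_add] at h2
    ext i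
    fin_cases i
    exacts [h0, h1, (mul_eq_zero.1 h2).resolve_left hk]
  set L' : (Fin 3 → ℝ) ≃L[ℝ] (Fin 3 → ℝ) :=
    (LinearEquiv.ofInjectiveEndo L.toLinearMap hinj).toContinuousLinearEquiv
  have hL' : (L' : (Fin 3 → ℝ) →L[ℝ] (Fin 3 → ℝ)) = L := ContinuousLinearMap.ext fun _ => rfl
  obtain ⟨e, hae, heF, he⟩ := hFs.exists_openPartialHomeomorph_analytic_symm
    (F' := L') (a := a) (by rw [hL']; exact hFL)
  refine ⟨e, hae, by rwa [heF], he, fun x hx => ?_⟩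
  rw [mem_doubleCone_two] at hx
  simp [heF, hF, hx]

/-! ## The catenoid as a DC-immersion -/

theorem analyticTransition_of_forall_eq {m : ℕ} {X : Type*} [TopologicalSpace X]
    {φ ψ : OpenPartialHomeomorph X (doubleCone m)}
    (h : ∀ a ∈ (φ.symm.trans ψ).source, ψ (φ.symm a) = a) : AnalyticTransition φ ψ := by
  obtain ⟨Ω, hΩ, hs⟩ := isOpen_induced_iff.1 (φ.symm.trans ψ).open_source
  exact ⟨Ω, id, hΩ, analyticOnNhd_id, hs, fun a ha => congrArg Subtype.val (h a ha).symm⟩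

theorem teHomeomorph_restrOpen_isChart {μ : ℝ} (hμ : 0 < μ) (hμ1 : μ ≠ 1)
    {U : Set (surfaceTE μ)} (hU : IsOpen U) :
    (surfaceTE.dcStructure μ hμ hμ1).IsChart
      ((teHomeomorph μ hμ hμ1).toOpenPartialHomeomorph.restrOpen U hU) := by
  rintro φ rfl
  exact ⟨analyticTransition_of_forall_eq fun a _ => (teHomeomorph μ hμ hμ1).apply_symm_apply a,
    analyticTransition_of_forall_eq fun a _ => (teHomeomorph μ hμ hμ1).apply_symm_apply a⟩

theorem isDCAnalytic_fTETilde {μ : ℝ} (hμ : 0 < μ) (hμ1 : μ ≠ 1) :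
    (surfaceTE.dcStructure μ hμ hμ1).IsDCAnalytic (fTETilde μ hμ) := by
  rintro φ rfl
  refine ⟨univ, fun a => ![teX0 μ (Real.arsinh (a 2 / ((1 - μ ^ 2) / (2 * μ))) / μ), a 0, a 1,
    teX3 μ (Real.arsinh (a 2 / ((1 - μ ^ 2) / (2 * μ))) / μ)], isOpen_univ, ?_, rfl,
    fun a _ => rfl⟩
  apply ContDiff.analyticOnNhd_of_omega
  have hs : ContDiff ℝ ⊤ fun a : Fin 3 → ℝ =>
      Real.arsinh (a 2 / ((1 - μ ^ 2) / (2 * μ))) / μ :=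
    (contDiff_arsinh_div_div μ _).comp (contDiff_apply ℝ ℝ 2)
  rw [contDiff_pi]
  intro i
  fin_cases i
  · exact (contDiff_teX0 μ).comp hs
  · exact contDiff_apply ℝ ℝ 0
  · exact contDiff_apply ℝ ℝ 1
  · exact (contDiff_teX3 μ).comp hs

/-! ### Null coordinates on de Sitter space and DC-regularity. -/

/-- The coordinates `(x₁, x₂, x₃ + σ x₀)` of de Sitter space, `σ = ±1`. -/
def nullCoord (σ : ℝ) (y : Fin 4 → ℝ) : Fin 3 → ℝ := ![y 1, y 2, y 3 + σ * y 0]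

/-- The inverse of `nullCoord`, on `x₃ + σ x₀ ≠ 0`. -/
noncomputable def nullCoordSymm (σ : ℝ) (z : Fin 3 → ℝ) : Fin 4 → ℝ :=
  ![σ * ((z 2 - (1 - z 0 ^ 2 - z 1 ^ 2) / z 2) / 2), z 0, z 1,
    (z 2 + (1 - z 0 ^ 2 - z 1 ^ 2) / z 2) / 2]

theorem contDiff_nullCoord (σ : ℝ) {n : WithTop ℕ∞} : ContDiff ℝ n (nullCoord σ) := by
  rw [contDiff_pi]
  intro i
  fin_cases i
  · exact contDiff_apply ℝ ℝ 1
  · exact contDiff_apply ℝ ℝ 2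
  · exact (contDiff_apply ℝ ℝ 3).add (contDiff_const.mul (contDiff_apply ℝ ℝ 0))

theorem contDiffAt_nullCoordSymm (σ : ℝ) {z : Fin 3 → ℝ} (hz : z 2 ≠ 0) {n : WithTop ℕ∞} :
    ContDiffAt ℝ n (nullCoordSymm σ) z := by
  have hc (i : Fin 3) : ContDiffAt ℝ n (fun z : Fin 3 → ℝ => z i) z :=
    (contDiff_apply ℝ ℝ i).contDiffAt
  have hq : ContDiffAt ℝ n (fun z : Fin 3 → ℝ => (1 - z 0 ^ 2 - z 1 ^ 2) / z 2) z :=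
    ((contDiffAt_const.sub ((hc 0).pow 2)).sub ((hc 1).pow 2)).div (hc 2) hz
  rw [contDiffAt_pi]
  intro i
  fin_cases i
  · exact contDiffAt_const.mul (((hc 2).sub hq).div_const 2)
  · exact hc 0
  · exact hc 1
  · exact ((hc 2).add hq).div_const 2

theorem nullCoordSymm_mem {σ : ℝ} (hσ : σ ^ 2 = 1) {z : Fin 3 → ℝ} (hz : z 2 ≠ 0) :
    nullCoordSymm σ z ∈ deSitter := by
  change -(σ * ((z 2 - (1 - z 0 ^ 2 - z 1 ^ 2) / z 2) / 2) *
    (σ * ((z 2 - (1 - z 0 ^ 2 - z 1 ^ 2) / z 2) / 2))) + z 0 * z 0 + z 1 * z 1 +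
    (z 2 + (1 - z 0 ^ 2 - z 1 ^ 2) / z 2) / 2 * ((z 2 + (1 - z 0 ^ 2 - z 1 ^ 2) / z 2) / 2) = 1
  have h : (1 - z 0 ^ 2 - z 1 ^ 2) / z 2 * z 2 = 1 - z 0 ^ 2 - z 1 ^ 2 := div_mul_cancel₀ _ hz
  linear_combination h - ((z 2 - (1 - z 0 ^ 2 - z 1 ^ 2) / z 2) / 2) ^ 2 * hσ

theorem nullCoord_nullCoordSymm {σ : ℝ} (hσ : σ ^ 2 = 1) (z : Fin 3 → ℝ) :
    nullCoord σ (nullCoordSymm σ z) = z := by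
  ext i
  fin_cases i
  · rfl
  · rfl
  · change (z 2 + (1 - z 0 ^ 2 - z 1 ^ 2) / z 2) / 2 +
      σ * (σ * ((z 2 - (1 - z 0 ^ 2 - z 1 ^ 2) / z 2) / 2)) = z 2
    linear_combination ((z 2 - (1 - z 0 ^ 2 - z 1 ^ 2) / z 2) / 2) * hσ

theorem nullCoordSymm_nullCoord {σ : ℝ} (hσ : σ ^ 2 = 1) {y : Fin 4 → ℝ} (hy : y ∈ deSitter)
    (h : y 3 + σ * y 0 ≠ 0) : nullCoordSymm σ (nullCoord σ y) = y := by
  have hy' : -(y 0 * y 0) + y 1 * y 1 + y 2 * y 2 + y 3 * y 3 = 1 := hy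
  have hq : (1 - y 1 ^ 2 - y 2 ^ 2) / (y 3 + σ * y 0) = y 3 - σ * y 0 := by
    rw [div_eq_iff h]
    linear_combination y 0 ^ 2 * hσ - hy'
  ext i
  fin_cases i
  · change σ * ((y 3 + σ * y 0 - (1 - y 1 ^ 2 - y 2 ^ 2) / (y 3 + σ * y 0)) / 2) = y 0
    rw [hq]
    linear_combination y 0 * hσ
  · rfl
  · rfl
  · change (y 3 + σ * y 0 + (1 - y 1 ^ 2 - y 2 ^ 2) / (y 3 + σ * y 0)) / 2 = y 3
    rw [hq]
    ring

/-- If both signs failed then x₀ = x₃ = 0, contradicting cosh s · x₃ - sinh s · x₀ = cosh μs > 0. So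
one of the two null charts covers each point of the image. -/
theorem exists_teX3_add_mul_teX0_ne_zero (μ s : ℝ) :
    ∃ σ : ℝ, σ ^ 2 = 1 ∧ teX3 μ s + σ * teX0 μ s ≠ 0 := by
  by_contra! h
  have h1 := h 1 (by norm_num)
  have h2 := h (-1) (by norm_num)
  have h0 : teX0 μ s = 0 := by linarith
  have h3 : teX3 μ s = 0 := by linarith
  have e3 : Real.cosh s * teX3 μ s - Real.sinh s * teX0 μ s = Real.cosh (μ * s) := by
    unfold teX0 teX3
    linear_combination Real.cosh (μ * s) * Real.cosh_sq s
  rw [h0, h3, mul_zero, mul_zero, sub_zero] at e3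
  exact (Real.cosh_pos _).ne e3

theorem hasDerivAt_sinh_mul (μ s : ℝ) :
    HasDerivAt (fun s => Real.sinh (μ * s)) (μ * Real.cosh (μ * s)) s := by
  simpa [mul_comm] using ((hasDerivAt_id s).const_mul μ).sinh

theorem hasDerivAt_cosh_mul (μ s : ℝ) :
    HasDerivAt (fun s => Real.cosh (μ * s)) (μ * Real.sinh (μ * s)) s := by
  simpa [mul_comm] using ((hasDerivAt_id s).const_mul μ).cosh

theorem hasDerivAt_teX0 {μ : ℝ} (hμ : 0 < μ) (s : ℝ) :
    HasDerivAt (teX0 μ) ((1 - μ ^ 2) / (2 * μ) *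
      (μ * Real.cosh s * Real.cosh (μ * s) - Real.sinh s * Real.sinh (μ * s))) s := by
  have h := ((Real.hasDerivAt_sinh s).mul (hasDerivAt_cosh_mul μ s)).sub
    ((((Real.hasDerivAt_cosh s).const_mul (μ ^ 2 + 1)).mul (hasDerivAt_sinh_mul μ s)).div_const
      (2 * μ))
  refine h.congr_deriv ?_
  field_simp
  ring

theorem hasDerivAt_teX3 {μ : ℝ} (hμ : 0 < μ) (s : ℝ) :
    HasDerivAt (teX3 μ) ((1 - μ ^ 2) / (2 * μ) *
      (μ * Real.sinh s * Real.cosh (μ * s) - Real.cosh s * Real.sinh (μ * s))) s := by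
  have h := ((Real.hasDerivAt_cosh s).mul (hasDerivAt_cosh_mul μ s)).sub
    ((((Real.hasDerivAt_sinh s).const_mul (μ ^ 2 + 1)).mul (hasDerivAt_sinh_mul μ s)).div_const
      (2 * μ))
  refine h.congr_deriv ?_
  field_simp
  ring

/-- In null coordinates the map is the restriction to the cone of the ambient local diffeomorphism
e. The target chart Φ is null coordinates followed by the inverse of e, and the DC-chart is the
global one restricted to where this makes sense. -/
theorem isDCRegularAt_fTETilde {μ : ℝ} (hμ : 0 < μ) (hμ1 : μ ≠ 1) (q : surfaceTE μ) :
    (surfaceTE.dcStructure μ hμ hμ1).IsDCRegularAt 3 (fTETilde μ hμ) q := by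
  have hc := te_const_ne_zero hμ hμ1
  obtain ⟨σ, hσ, hq⟩ := exists_teX3_add_mul_teX0_ne_zero μ (q.1 2)
  set s : ℝ → ℝ := fun z => Real.arsinh (z / ((1 - μ ^ 2) / (2 * μ))) / μ with hs
  set p : ℝ → ℝ := fun z => teX3 μ (s z) + σ * teX0 μ (s z) with hp
  have hsc : ContDiff ℝ ⊤ s := contDiff_arsinh_div_div μ _
  have hpc : ContDiff ℝ ⊤ p :=
    ((contDiff_teX3 μ).comp hsc).add (contDiff_const.mul ((contDiff_teX0 μ).comp hsc))
  -- At 0 the derivative of x₃ vanishes, that of x₀ is cμ, and that of s is 1/(cμ), so p'(0) = σ.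
  have hp0 : deriv p 0 ≠ 0 := by
    have hs0 : s 0 = 0 := by simp [hs]
    have h1 : HasDerivAt s (1 / ((1 - μ ^ 2) / (2 * μ)) / μ) 0 := by
      have := (((hasDerivAt_id (0 : ℝ)).div_const ((1 - μ ^ 2) / (2 * μ))).arsinh).div_const μ
      simpa using this
    have h3 := hasDerivAt_teX3 hμ (s 0)
    have h0 := hasDerivAt_teX0 hμ (s 0)
    have h := (h3.comp (0 : ℝ) h1).add ((h0.comp (0 : ℝ) h1).const_mul σ)
    rw [HasDerivAt.deriv (f := p) h, hs0]
    have hσ0 : σ ≠ 0 := by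
      rintro rfl
      norm_num at hσ
    simp only [mul_zero, Real.sinh_zero, Real.cosh_zero, zero_mul, sub_zero, mul_one, zero_add]
    have := hμ.ne'
    positivity
  set φ₀ := teHomeomorph μ hμ hμ1
  obtain ⟨e, hqe, hec, hes, hecone⟩ :=
    exists_openPartialHomeomorph_eqOn_doubleCone hpc (φ₀ q : Fin 3 → ℝ) hp0
  have hef (r : surfaceTE μ) : e (φ₀ r : Fin 3 → ℝ) = nullCoord σ (fTETilde μ hμ r) := by
    rw [hecone _ (φ₀ r).2]
    have hr : s ((φ₀ r : Fin 3 → ℝ) 2) = r.1 2 := by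
      change Real.arsinh ((1 - μ ^ 2) / (2 * μ) * Real.sinh (μ * r.1 2)
        / ((1 - μ ^ 2) / (2 * μ))) / μ = r.1 2
      rw [mul_div_cancel_left₀ _ hc, Real.arsinh_sinh, mul_div_cancel_left₀ _ hμ.ne']
    simp only [hp, hr]
    rfl
  have hO1 : Continuous (nullCoord σ) := (contDiff_nullCoord σ (n := 0)).continuous
  set O : Set (Fin 4 → ℝ) := {y | y 3 + σ * y 0 ≠ 0} ∩ nullCoord σ ⁻¹' e.target with hO
  set V : Set (Fin 3 → ℝ) := e.source ∩ {a | e a 2 ≠ 0} with hV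
  have hOo : IsOpen O :=
    (isOpen_ne_fun (by fun_prop) continuous_const).inter (e.open_target.preimage hO1)
  have hVo : IsOpen V := e.open_source.inter
    (isOpen_ne_fun ((continuous_apply 2).comp hec.continuous) continuous_const)
  obtain ⟨Φ, hΦ, hΦs, hΦK⟩ := exists_isAnalyticDiffeo (N := deSitter) (fTETilde μ hμ q) hOo hVo
    (K := e.symm ∘ nullCoord σ) (J := nullCoordSymm σ ∘ e)
    (fun y hy => (hes _ hy.2).comp ((contDiff_nullCoord σ).analyticOnNhd_of_omega univ y trivial))
    (fun a ha => ((contDiffAt_nullCoordSymm σ ha.2).analyticAt).comp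
      (hec.analyticOnNhd_of_omega univ a trivial))
    (fun y _ hyO => by
      refine ⟨e.map_target hyO.2, ?_⟩
      change e (e.symm (nullCoord σ y)) 2 ≠ 0
      rw [e.right_inv hyO.2]
      exact hyO.1)
    (fun a ha => nullCoordSymm_mem hσ ha.2)
    (fun a ha => by
      have h := nullCoord_nullCoordSymm hσ (e a)
      refine ⟨?_, ?_⟩
      · have h2 := congrFun h 2
        change nullCoordSymm σ (e a) 3 + σ * nullCoordSymm σ (e a) 0 = _ at h2
        change nullCoordSymm σ (e a) 3 + σ * nullCoordSymm σ (e a) 0 ≠ 0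
        rw [h2]
        exact ha.2
      · rw [mem_preimage, Function.comp_apply, h]
        exact e.map_source ha.1)
    (fun y hy hyO => by
      simp only [Function.comp_apply]
      rw [e.right_inv hyO.2, nullCoordSymm_nullCoord hσ hy hyO.1])
    (fun a ha => by
      simp only [Function.comp_apply]
      rw [nullCoord_nullCoordSymm hσ, e.left_inv ha.1])
  have hval : Continuous fun r : surfaceTE μ => (φ₀ r : Fin 3 → ℝ) :=
    continuous_subtype_val.comp φ₀.continuous
  have hU : IsOpen ((fun r : surfaceTE μ => (φ₀ r : Fin 3 → ℝ)) ⁻¹' V) := hVo.preimage hval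
  have hmem (r : surfaceTE μ) (hr : (φ₀ r : Fin 3 → ℝ) ∈ V) :
      fTETilde μ hμ r ∈ Φ.source ∧ Φ (fTETilde μ hμ r) = (φ₀ r : Fin 3 → ℝ) := by
    refine ⟨?_, ?_⟩
    · rw [hΦs]
      refine ⟨?_, ?_⟩
      · have := hr.2
        rw [mem_ofPred_eq, hef] at this
        exact this
      · rw [mem_preimage, ← hef]
        exact e.map_source hr.1
    · rw [hΦK, Function.comp_apply, ← hef, e.left_inv hr.1]
  refine ⟨φ₀.toOpenPartialHomeomorph.restrOpen _ hU, Φ, teHomeomorph_restrOpen_isChart hμ hμ1 hU,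
    ⟨trivial, hqe, ?_⟩, hΦ, fun a ha => ?_⟩
  · rw [mem_ofPred_eq, hef]
    exact hq
  · have h := hmem (φ₀.symm a) ha.2
    rw [φ₀.apply_symm_apply] at h
    refine ⟨h.1, h.2.trans ?_⟩
    ext i
    fin_cases i <;> rfl

theorem isDCImmersion_fTETilde {μ : ℝ} (hμ : 0 < μ) (hμ1 : μ ≠ 1) :
    (surfaceTE.dcStructure μ hμ hμ1).IsDCImmersion 3 (fTETilde μ hμ) :=
  ⟨by norm_num, isDCAnalytic_fTETilde hμ hμ1, isDCRegularAt_fTETilde hμ hμ1⟩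

/-! ## The space-like CMC-1 property -/

/-- On a surface of revolution every coordinate separates as α(s)β(θ). Partial derivatives keep this
form, so the computation can be iterated for second derivatives. -/
theorem hasFDerivAt_mul_coord {k : ℕ} {α β α' β' : Fin k → ℝ → ℝ}
    (hα : ∀ i s, HasDerivAt (α i) (α' i s) s) (hβ : ∀ i s, HasDerivAt (β i) (β' i s) s)
    (u : Fin 2 → ℝ) :
    HasFDerivAt (fun u : Fin 2 → ℝ => fun i => α i (u 0) * β i (u 1))
      (ContinuousLinearMap.pi fun i =>
        (α i (u 0) * β' i (u 1)) • (ContinuousLinearMap.proj 1 : (Fin 2 → ℝ) →L[ℝ] ℝ)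
          + (α' i (u 0) * β i (u 1)) • ContinuousLinearMap.proj 0) u := by
  rw [hasFDerivAt_pi]
  intro i
  have h0 : HasFDerivAt (fun u : Fin 2 → ℝ => u 0)
      (ContinuousLinearMap.proj 0 : (Fin 2 → ℝ) →L[ℝ] ℝ) u :=
    hasFDerivAt_apply 0 u
  have h1 : HasFDerivAt (fun u : Fin 2 → ℝ => u 1)
      (ContinuousLinearMap.proj 1 : (Fin 2 → ℝ) →L[ℝ] ℝ) u :=
    hasFDerivAt_apply 1 u
  refine (((hα i (u 0)).comp_hasFDerivAt u h0).mul
    ((hβ i (u 1)).comp_hasFDerivAt u h1)).congr_fderiv ?_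
  ext1 v
  simp
  ring

theorem partialD_zero_mul_coord {α β α' β' : Fin 4 → ℝ → ℝ}
    (hα : ∀ i s, HasDerivAt (α i) (α' i s) s) (hβ : ∀ i s, HasDerivAt (β i) (β' i s) s) :
    partialD 0 (fun u : Fin 2 → ℝ => fun i => α i (u 0) * β i (u 1)) =
      fun u i => α' i (u 0) * β i (u 1) := by
  funext u i
  rw [partialD, (hasFDerivAt_mul_coord hα hβ u).fderiv]
  simp

theorem partialD_one_mul_coord {α β α' β' : Fin 4 → ℝ → ℝ}
    (hα : ∀ i s, HasDerivAt (α i) (α' i s) s) (hβ : ∀ i s, HasDerivAt (β i) (β' i s) s) :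
    partialD 1 (fun u : Fin 2 → ℝ => fun i => α i (u 0) * β i (u 1)) =
      fun u i => α i (u 0) * β' i (u 1) := by
  funext u i
  rw [partialD, (hasFDerivAt_mul_coord hα hβ u).fderiv]
  simp

/-- Polar coordinates on `X_TE^μ`. -/
noncomputable def tePolar (μ : ℝ) (hμ : 0 < μ) (u : Fin 2 → ℝ) : surfaceTE μ :=
  teProj μ hμ (u 0, ((u 1 : ℝ) : Real.Angle))

theorem hasDerivAt_const_mul_sinh {μ : ℝ} (c s : ℝ) :
    HasDerivAt (fun s => c * Real.sinh (μ * s)) (c * (μ * Real.cosh (μ * s))) s :=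
  (hasDerivAt_sinh_mul μ s).const_mul c

theorem isLocalParam_tePolar {μ : ℝ} (hμ : 0 < μ) (hμ1 : μ ≠ 1) :
    (surfaceTE.dcStructure μ hμ hμ1).IsLocalParam {u | u 0 ≠ 0} (tePolar μ hμ) := by
  have hc := te_const_ne_zero hμ hμ1
  have hcoord (i : Fin 2) : ContDiff ℝ ⊤ fun u : Fin 2 → ℝ => u i := contDiff_apply ℝ ℝ i
  set c := (1 - μ ^ 2) / (2 * μ) with hcdef
  have hr : ContDiff ℝ ⊤ fun u : Fin 2 → ℝ => c * Real.sinh (μ * u 0) :=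
    (contDiff_const_mul_sinh μ c).comp (hcoord 0)
  have hx : ContDiff ℝ ⊤ fun u : Fin 2 → ℝ => (tePolar μ hμ u : Fin 3 → ℝ) := by
    simp only [tePolar, teProj_coe]
    rw [contDiff_pi]
    intro i
    fin_cases i
    · exact hr.mul (Real.contDiff_cos.comp (hcoord 1))
    · exact hr.mul (Real.contDiff_sin.comp (hcoord 1))
    · exact hcoord 0
  have hφ : (fun u : Fin 2 → ℝ => (teHomeomorph μ hμ hμ1 (tePolar μ hμ u) : Fin 3 → ℝ)) =
      fun u i => (fun s => c * Real.sinh (μ * s)) (u 0) *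
        (![Real.cos, Real.sin, fun _ => 1] : Fin 3 → ℝ → ℝ) i (u 1) := by
    funext u i
    have h := teProj_coe μ hμ (u 0) (u 1)
    fin_cases i
    · exact congrFun h 0
    · exact congrFun h 1
    · change c * Real.sinh (μ * (teProj μ hμ (u 0, (u 1 : Real.Angle)) : Fin 3 → ℝ) 2) =
        c * Real.sinh (μ * u 0) * 1
      rw [h, mul_one]
      rfl
  refine ⟨isOpen_ne_fun (continuous_apply 0) continuous_const, ?_, fun u hu => ?_, ?_, ?_⟩
  · exact (Continuous.subtype_mk hx.continuous fun u => (tePolar μ hμ u).2).continuousOn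
  · rw [isDCPoint_surfaceTE_iff, surfaceTE_eq_zero_iff]
    exact hu
  · rintro φ rfl
    apply ContDiff.analyticOnNhd_of_omega
    change ContDiff ℝ ⊤ fun u => (teHomeomorph μ hμ hμ1 (tePolar μ hμ u) : Fin 3 → ℝ)
    rw [hφ, contDiff_pi]
    intro i
    fin_cases i
    · exact hr.mul (Real.contDiff_cos.comp (hcoord 1))
    · exact hr.mul (Real.contDiff_sin.comp (hcoord 1))
    · exact hr.mul contDiff_const
  · rintro φ rfl u ⟨hu, -⟩
    change Function.Injective
      (fderiv ℝ (fun u => (teHomeomorph μ hμ hμ1 (tePolar μ hμ u) : Fin 3 → ℝ)) u)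
    have hβ : ∀ (i : Fin 3) (t : ℝ), HasDerivAt
        ((![Real.cos, Real.sin, fun _ => 1] : Fin 3 → ℝ → ℝ) i)
        ((![fun t => -Real.sin t, Real.cos, fun _ => 0] : Fin 3 → ℝ → ℝ) i t) t := by
      intro i t
      fin_cases i
      exacts [Real.hasDerivAt_cos t, Real.hasDerivAt_sin t, hasDerivAt_const t 1]
    rw [hφ, (hasFDerivAt_mul_coord
      (fun _ s => hasDerivAt_const_mul_sinh c s) hβ u).fderiv, injective_iff_map_eq_zero]
    intro v hv
    have e0 := congrFun hv 0
    have e1 := congrFun hv 1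
    have e2 := congrFun hv 2
    simp [hc, hμ.ne', (Real.cosh_pos _).ne'] at e0 e1 e2
    rw [e2] at e0 e1
    have hsh : Real.sinh (μ * u 0) ≠ 0 := by
      rw [Ne, Real.sinh_eq_zero]
      exact mul_ne_zero hμ.ne' hu
    -- Pairing the first two components with the angular direction (-sin θ, cos θ) isolates the
    -- θ-component of v.
    have hv1 : c * Real.sinh (μ * u 0) * v 1 = 0 := by
      linear_combination (Real.cos (u 1)) * e1 - (Real.sin (u 1)) * e0
        - c * Real.sinh (μ * u 0) * v 1 * Real.sin_sq_add_cos_sq (u 1)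
    ext i
    fin_cases i
    · exact e2
    · exact (mul_eq_zero.1 hv1).resolve_left (mul_ne_zero hc hsh)

theorem fTETilde_tePolar (μ : ℝ) (hμ : 0 < μ) :
    (fun u : Fin 2 → ℝ => (fTETilde μ hμ (tePolar μ hμ u) : Fin 4 → ℝ)) =
      fun u i => (![teX0 μ, fun s => (1 - μ ^ 2) / (2 * μ) * Real.sinh (μ * s),
          fun s => (1 - μ ^ 2) / (2 * μ) * Real.sinh (μ * s), teX3 μ] : Fin 4 → ℝ → ℝ) i (u 0) *
        (![fun _ => 1, Real.cos, Real.sin, fun _ => 1] : Fin 4 → ℝ → ℝ) i (u 1) := by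
  funext u i
  rw [tePolar, ← fTE_eq_fTETilde_teProj, fTE_coe]
  fin_cases i <;> simp

/-! ### The unit normal and the fundamental forms in polar coordinates. -/

/-- The unit normal field of the catenoid at `(ξ, η, s)`, `s ≠ 0`. -/
noncomputable def teNormal (μ : ℝ) (p : Fin 3 → ℝ) : Fin 4 → ℝ :=
  let c := (1 - μ ^ 2) / (2 * μ)
  let sh := Real.sinh (μ * p 2)
  let ch := Real.cosh (μ * p 2)
  let α := (μ * ch ^ 2 + c * sh ^ 2) / sh
  let γ := (μ * ch ^ 2 - (μ ^ 2 + 1) / (2 * μ) * sh ^ 2) / sh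
  ![α * Real.cosh (p 2) - ch * Real.sinh (p 2), γ * (p 0 / (c * sh)), γ * (p 1 / (c * sh)),
    α * Real.sinh (p 2) - ch * Real.cosh (p 2)]

theorem continuousOn_teNormal {μ : ℝ} (hμ : 0 < μ) (hμ1 : μ ≠ 1) :
    ContinuousOn (teNormal μ) {p | p 2 ≠ 0} := by
  have hc := te_const_ne_zero hμ hμ1
  have hcoord (i : Fin 3) : ContinuousOn (fun p : Fin 3 → ℝ => p i) {p | p 2 ≠ 0} :=
    (continuous_apply i).continuousOn
  have hsh : ContinuousOn (fun p : Fin 3 → ℝ => Real.sinh (μ * p 2)) {p | p 2 ≠ 0} :=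
    (Real.continuous_sinh.comp (continuous_const.mul (continuous_apply 2))).continuousOn
  have hch : ContinuousOn (fun p : Fin 3 → ℝ => Real.cosh (μ * p 2)) {p | p 2 ≠ 0} :=
    (Real.continuous_cosh.comp (continuous_const.mul (continuous_apply 2))).continuousOn
  have hS : ContinuousOn (fun p : Fin 3 → ℝ => Real.sinh (p 2)) {p | p 2 ≠ 0} :=
    (Real.continuous_sinh.comp (continuous_apply 2)).continuousOn
  have hC : ContinuousOn (fun p : Fin 3 → ℝ => Real.cosh (p 2)) {p | p 2 ≠ 0} :=
    (Real.continuous_cosh.comp (continuous_apply 2)).continuousOn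
  have h0 : ∀ p ∈ {p : Fin 3 → ℝ | p 2 ≠ 0}, Real.sinh (μ * p 2) ≠ 0 := fun p hp => by
    rw [Ne, Real.sinh_eq_zero]
    exact mul_ne_zero hμ.ne' hp
  have hα := ((continuousOn_const (c := μ)).mul (hch.pow 2) |>.add
    ((continuousOn_const (c := (1 - μ ^ 2) / (2 * μ))).mul (hsh.pow 2))).div hsh h0
  have hγ := ((continuousOn_const (c := μ)).mul (hch.pow 2) |>.sub
    ((continuousOn_const (c := (μ ^ 2 + 1) / (2 * μ))).mul (hsh.pow 2))).div hsh h0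
  have hr := (continuousOn_const (c := (1 - μ ^ 2) / (2 * μ))).mul hsh
  have hr0 : ∀ p ∈ {p : Fin 3 → ℝ | p 2 ≠ 0}, (1 - μ ^ 2) / (2 * μ) * Real.sinh (μ * p 2) ≠ 0 :=
    fun p hp => mul_ne_zero hc (h0 p hp)
  rw [continuousOn_pi]
  intro i
  fin_cases i
  · exact (hα.mul hC).sub (hch.mul hS)
  · exact hγ.mul ((hcoord 0).div hr hr0)
  · exact hγ.mul ((hcoord 1).div hr hr0)
  · exact (hα.mul hS).sub (hch.mul hC)

/-- Removes the divisions by sinh μs: the quotient becomes an unknown a with one polynomial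
relation, and the radial component is a - (μ + 2c) sinh μs. Later checks are then polynomial
identities. -/
theorem exists_teNormal_tePolar {μ c : ℝ} (hμ : 0 < μ) (hμ1 : μ ≠ 1)
    (hc : c = (1 - μ ^ 2) / (2 * μ)) {u : Fin 2 → ℝ} (hu : u 0 ≠ 0) :
    ∃ a : ℝ, a * Real.sinh (μ * u 0) =
        μ * Real.cosh (μ * u 0) ^ 2 + c * Real.sinh (μ * u 0) ^ 2 ∧
      teNormal μ (tePolar μ hμ u) =
        ![a * Real.cosh (u 0) - Real.cosh (μ * u 0) * Real.sinh (u 0),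
          (a - (μ + 2 * c) * Real.sinh (μ * u 0)) * Real.cos (u 1),
          (a - (μ + 2 * c) * Real.sinh (μ * u 0)) * Real.sin (u 1),
          a * Real.sinh (u 0) - Real.cosh (μ * u 0) * Real.cosh (u 0)] := by
  have hsh : Real.sinh (μ * u 0) ≠ 0 := by
    rw [Ne, Real.sinh_eq_zero]
    exact mul_ne_zero hμ.ne' hu
  have hr : c * Real.sinh (μ * u 0) ≠ 0 := mul_ne_zero (hc ▸ te_const_ne_zero hμ hμ1) hsh
  have h2 : (tePolar μ hμ u : Fin 3 → ℝ) 2 = u 0 := rfl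
  have h0 : (tePolar μ hμ u : Fin 3 → ℝ) 0 = c * Real.sinh (μ * u 0) * Real.cos (u 1) :=
    hc ▸ congrFun (teProj_coe μ hμ (u 0) (u 1)) 0
  have h1 : (tePolar μ hμ u : Fin 3 → ℝ) 1 = c * Real.sinh (μ * u 0) * Real.sin (u 1) :=
    hc ▸ congrFun (teProj_coe μ hμ (u 0) (u 1)) 1
  have hA : (μ ^ 2 + 1) / (2 * μ) = μ + c := by
    rw [hc]
    field_simp
    ring
  refine ⟨(μ * Real.cosh (μ * u 0) ^ 2 + c * Real.sinh (μ * u 0) ^ 2) / Real.sinh (μ * u 0),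
    div_mul_cancel₀ _ hsh, ?_⟩
  have hγ : (μ * Real.cosh (μ * u 0) ^ 2 - (μ + c) * Real.sinh (μ * u 0) ^ 2)
      / Real.sinh (μ * u 0) = (μ * Real.cosh (μ * u 0) ^ 2 + c * Real.sinh (μ * u 0) ^ 2)
      / Real.sinh (μ * u 0) - (μ + 2 * c) * Real.sinh (μ * u 0) := by
    field_simp
    ring
  simp only [teNormal, h0, h1, h2, ← hc, hA, hγ, mul_div_cancel_left₀ _ hr]

theorem posDef_smul_one_fin_two {E : ℝ} (hE : 0 < E) :
    (E • (1 : Matrix (Fin 2) (Fin 2) ℝ)).PosDef :=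
  Matrix.PosDef.one.smul hE

/-- In conformal coordinates the mean curvature is a multiple of the trace of the second form. -/
theorem meanCurvature_of_conformal {g : (Fin 2 → ℝ) → (Fin 4 → ℝ)} {n : Fin 4 → ℝ}
    {u : Fin 2 → ℝ} {E : ℝ} (hE : E ≠ 0) (h : firstForm g u = E • 1) :
    meanCurvature g n u = (lorentz (partialD 0 (partialD 0 g) u) n +
      lorentz (partialD 1 (partialD 1 g) u) n) / (2 * E) := by
  have hinv : (firstForm g u)⁻¹ = E⁻¹ • 1 := by
    refine Matrix.inv_eq_right_inv ?_
    rw [h, Matrix.smul_mul, Matrix.one_mul, smul_smul, mul_inv_cancel₀ hE, one_smul]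
  rw [meanCurvature, hinv, Matrix.smul_mul, Matrix.one_mul, Matrix.trace_smul,
    Matrix.trace_fin_two]
  simp only [secondForm, Matrix.of_apply, smul_eq_mul]
  field_simp

/-- The mixed second derivative is omitted because the coordinates are conformal, so it does not
enter the mean curvature. -/
theorem partialD_fTETilde_tePolar {μ : ℝ} (hμ : 0 < μ) (u : Fin 2 → ℝ) :
    let c := (1 - μ ^ 2) / (2 * μ)
    let g := fun u => (fTETilde μ hμ (tePolar μ hμ u) : Fin 4 → ℝ)
    let x0' := c * (μ * Real.cosh (u 0) * Real.cosh (μ * u 0) -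
      Real.sinh (u 0) * Real.sinh (μ * u 0))
    let x3' := c * (μ * Real.sinh (u 0) * Real.cosh (μ * u 0) -
      Real.cosh (u 0) * Real.sinh (μ * u 0))
    partialD 0 g u = ![x0', c * (μ * Real.cosh (μ * u 0)) * Real.cos (u 1),
        c * (μ * Real.cosh (μ * u 0)) * Real.sin (u 1), x3'] ∧
      partialD 1 g u = ![0, -(c * Real.sinh (μ * u 0) * Real.sin (u 1)),
        c * Real.sinh (μ * u 0) * Real.cos (u 1), 0] ∧
      partialD 0 (partialD 0 g) u = ![c * ((μ ^ 2 - 1) * Real.cosh (u 0) * Real.sinh (μ * u 0)),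
        c * (μ ^ 2 * Real.sinh (μ * u 0)) * Real.cos (u 1),
        c * (μ ^ 2 * Real.sinh (μ * u 0)) * Real.sin (u 1),
        c * ((μ ^ 2 - 1) * Real.sinh (u 0) * Real.sinh (μ * u 0))] ∧
      partialD 1 (partialD 1 g) u = ![0, -(c * Real.sinh (μ * u 0) * Real.cos (u 1)),
        -(c * Real.sinh (μ * u 0) * Real.sin (u 1)), 0] := by
  intro c g x0' x3'
  set α : Fin 4 → ℝ → ℝ := ![teX0 μ, fun s => c * Real.sinh (μ * s),
    fun s => c * Real.sinh (μ * s), teX3 μ] with hαdef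
  set α' : Fin 4 → ℝ → ℝ := ![fun s => c * (μ * Real.cosh s * Real.cosh (μ * s) -
      Real.sinh s * Real.sinh (μ * s)), fun s => c * (μ * Real.cosh (μ * s)),
    fun s => c * (μ * Real.cosh (μ * s)), fun s => c * (μ * Real.sinh s * Real.cosh (μ * s) -
      Real.cosh s * Real.sinh (μ * s))] with hα'def
  set α'' : Fin 4 → ℝ → ℝ := ![fun s => c * ((μ ^ 2 - 1) * Real.cosh s * Real.sinh (μ * s)),
    fun s => c * (μ ^ 2 * Real.sinh (μ * s)), fun s => c * (μ ^ 2 * Real.sinh (μ * s)),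
    fun s => c * ((μ ^ 2 - 1) * Real.sinh s * Real.sinh (μ * s))] with hα''def
  set β : Fin 4 → ℝ → ℝ := ![fun _ => 1, Real.cos, Real.sin, fun _ => 1] with hβdef
  set β' : Fin 4 → ℝ → ℝ := ![fun _ => 0, fun t => -Real.sin t, Real.cos, fun _ => 0] with hβ'def
  set β'' : Fin 4 → ℝ → ℝ := ![fun _ => 0, fun t => -Real.cos t, fun t => -Real.sin t,
    fun _ => 0] with hβ''def
  have hα (i : Fin 4) (s : ℝ) : HasDerivAt (α i) (α' i s) s := by
    fin_cases i
    exacts [hasDerivAt_teX0 hμ s, hasDerivAt_const_mul_sinh c s, hasDerivAt_const_mul_sinh c s,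
      hasDerivAt_teX3 hμ s]
  have hch (s : ℝ) : HasDerivAt (fun s => c * (μ * Real.cosh (μ * s)))
      (c * (μ ^ 2 * Real.sinh (μ * s))) s :=
    (((hasDerivAt_cosh_mul μ s).const_mul μ).const_mul c).congr_deriv (by ring)
  have hα' (i : Fin 4) (s : ℝ) : HasDerivAt (α' i) (α'' i s) s := by
    fin_cases i
    · exact (((((Real.hasDerivAt_cosh s).const_mul μ).mul (hasDerivAt_cosh_mul μ s)).sub
        ((Real.hasDerivAt_sinh s).mul (hasDerivAt_sinh_mul μ s))).const_mul c).congr_deriv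
          (by simp [hα''def]; ring_nf; simp)
    · exact hch s
    · exact hch s
    · exact (((((Real.hasDerivAt_sinh s).const_mul μ).mul (hasDerivAt_cosh_mul μ s)).sub
        ((Real.hasDerivAt_cosh s).mul (hasDerivAt_sinh_mul μ s))).const_mul c).congr_deriv
          (by simp [hα''def]; ring_nf; simp)
  have hβ (i : Fin 4) (t : ℝ) : HasDerivAt (β i) (β' i t) t := by
    fin_cases i
    exacts [hasDerivAt_const t 1, Real.hasDerivAt_cos t, Real.hasDerivAt_sin t,
      hasDerivAt_const t 1]
  have hβ' (i : Fin 4) (t : ℝ) : HasDerivAt (β' i) (β'' i t) t := by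
    fin_cases i
    exacts [hasDerivAt_const t 0, (Real.hasDerivAt_sin t).neg, Real.hasDerivAt_cos t,
      hasDerivAt_const t 0]
  have hg : g = fun u i => α i (u 0) * β i (u 1) := fTETilde_tePolar μ hμ
  rw [hg, partialD_zero_mul_coord hα hβ, partialD_one_mul_coord hα hβ,
    partialD_zero_mul_coord hα' hβ, partialD_one_mul_coord hα hβ']
  refine ⟨?_, ?_, ?_, ?_⟩ <;> ext i <;> fin_cases i <;>
    simp [hαdef, hα'def, hα''def, hβdef, hβ'def, hβ''def, x0', x3']

theorem firstForm_tePolar {μ : ℝ} (hμ : 0 < μ) (u : Fin 2 → ℝ) :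
    firstForm (fun u => (fTETilde μ hμ (tePolar μ hμ u) : Fin 4 → ℝ)) u =
      ((1 - μ ^ 2) / (2 * μ) * Real.sinh (μ * u 0)) ^ 2 • 1 := by
  obtain ⟨h0, h1, -, -⟩ := partialD_fTETilde_tePolar hμ u
  have hC := Real.cosh_sq (u 0)
  have ht := Real.sin_sq_add_cos_sq (u 1)
  set c := (1 - μ ^ 2) / (2 * μ)
  ext i j
  fin_cases i <;> fin_cases j <;> simp [firstForm, h0, h1, lorentz]
  · linear_combination c ^ 2 * (Real.sinh (μ * u 0) ^ 2 - μ ^ 2 * Real.cosh (μ * u 0) ^ 2) * hC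
      + (c * (μ * Real.cosh (μ * u 0))) ^ 2 * ht
  · ring
  · ring
  · linear_combination (c * Real.sinh (μ * u 0)) ^ 2 * ht

theorem isUnitNormal_teNormal {μ : ℝ} (hμ : 0 < μ) (hμ1 : μ ≠ 1) {u : Fin 2 → ℝ}
    (hu : u 0 ≠ 0) :
    IsUnitNormal (fun u => (fTETilde μ hμ (tePolar μ hμ u) : Fin 4 → ℝ))
      (teNormal μ (tePolar μ hμ u)) u := by
  obtain ⟨h0, h1, -, -⟩ := partialD_fTETilde_tePolar hμ u
  have hg : (fTETilde μ hμ (tePolar μ hμ u) : Fin 4 → ℝ) = _ :=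
    (congrArg Subtype.val (fTE_eq_fTETilde_teProj μ hμ (u 0, (u 1 : Real.Angle)))).symm.trans
      (fTE_coe μ hμ (u 0) (u 1))
  have hC := Real.cosh_sq (u 0)
  have hch := Real.cosh_sq (μ * u 0)
  have ht := Real.sin_sq_add_cos_sq (u 1)
  obtain ⟨c, hc⟩ : ∃ c, c = (1 - μ ^ 2) / (2 * μ) := ⟨_, rfl⟩
  -- The only relation between c and μ needed below; it also gives (μ² + 1)/(2μ) = μ + c.
  have hcμ : μ ^ 2 + 2 * c * μ = 1 := by
    rw [hc]
    field_simp
    ring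
  have hX0 : teX0 μ (u 0) = Real.sinh (u 0) * Real.cosh (μ * u 0)
      - (μ + c) * Real.cosh (u 0) * Real.sinh (μ * u 0) := by
    rw [teX0, hc]
    field_simp
    ring
  have hX3 : teX3 μ (u 0) = Real.cosh (u 0) * Real.cosh (μ * u 0)
      - (μ + c) * Real.sinh (u 0) * Real.sinh (μ * u 0) := by
    rw [teX3, hc]
    field_simp
    ring
  obtain ⟨a, ha, hn⟩ := exists_teNormal_tePolar hμ hμ1 hc hu
  rw [← hc] at h0 h1 hg
  rw [hX0, hX3] at hg
  rw [hn]
  generalize Real.cosh (u 0) = C at *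
  generalize Real.sinh (u 0) = S at *
  generalize Real.cosh (μ * u 0) = ch at *
  generalize Real.sinh (μ * u 0) = sh at *
  generalize Real.cos (u 1) = co at *
  generalize Real.sin (u 1) = si at *
  refine ⟨?_, ?_, fun i => ?_⟩
  · simp only [lorentz, Matrix.cons_val]
    linear_combination (ch ^ 2 - a ^ 2) * hC + (a - (μ + 2 * c) * sh) ^ 2 * ht
      - 2 * (μ + 2 * c) * ha + (sh ^ 2 - 2 * ch ^ 2) * hcμ - hch
  · simp only [lorentz, hg, Matrix.cons_val]
    linear_combination ((μ + c) * a * sh - ch ^ 2) * hC + (a - (μ + 2 * c) * sh) * c * sh * ht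
      + (μ + 2 * c) * ha + ch ^ 2 * hcμ
  · fin_cases i
    · simp only [lorentz, Fin.zero_eta, h0, Matrix.cons_val]
      linear_combination c * ch * (sh - a * μ) * hC
        + (a - (μ + 2 * c) * sh) * c * μ * ch * ht - c * ch * sh * hcμ
    · simp only [lorentz, Fin.mk_one, h1, Matrix.cons_val]
      ring

/-- Let e = (cosh s, 0, 0, sinh s) and let ρ be the radial unit vector. Then f_ss + f_θθ = c(μ² - 1)
sinh μs · (e + ρ), a null vector. Its product with the normal is -c(μ² - 1)(μ + 2c) sinh² μs; by 1 -
μ² = 2cμ and μ(μ + 2c) = 1 this is 2c² sinh² μs, twice the conformal factor. -/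
theorem meanCurvature_teNormal {μ : ℝ} (hμ : 0 < μ) (hμ1 : μ ≠ 1) {u : Fin 2 → ℝ}
    (hu : u 0 ≠ 0) :
    meanCurvature (fun u => (fTETilde μ hμ (tePolar μ hμ u) : Fin 4 → ℝ))
      (teNormal μ (tePolar μ hμ u)) u = 1 := by
  obtain ⟨-, -, h00, h11⟩ := partialD_fTETilde_tePolar hμ u
  have hsh : Real.sinh (μ * u 0) ≠ 0 := by
    rw [Ne, Real.sinh_eq_zero]
    exact mul_ne_zero hμ.ne' hu
  have hr := mul_ne_zero (te_const_ne_zero hμ hμ1) hsh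
  have hE := firstForm_tePolar hμ u
  obtain ⟨c, hc⟩ : ∃ c, c = (1 - μ ^ 2) / (2 * μ) := ⟨_, rfl⟩
  have hcμ : μ ^ 2 + 2 * c * μ = 1 := by
    rw [hc]
    field_simp
    ring
  obtain ⟨a, ha, hn⟩ := exists_teNormal_tePolar hμ hμ1 hc hu
  rw [← hc] at h00 h11 hr hE
  have hE0 := pow_ne_zero 2 hr
  rw [meanCurvature_of_conformal hE0 hE, div_eq_one_iff_eq (mul_ne_zero two_ne_zero hE0), hn]
  simp only [lorentz, h00, h11, Matrix.cons_val]
  have hC := Real.cosh_sq (u 0)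
  have ht := Real.sin_sq_add_cos_sq (u 1)
  generalize Real.cosh (u 0) = C at *
  generalize Real.sinh (u 0) = S at *
  generalize Real.cosh (μ * u 0) = ch at *
  generalize Real.sinh (μ * u 0) = sh at *
  generalize Real.cos (u 1) = co at *
  generalize Real.sin (u 1) = si at *
  linear_combination -(c * (μ ^ 2 - 1) * sh * a) * hC
    + c * (μ ^ 2 - 1) * sh * (a - (μ + 2 * c) * sh) * ht
    - c * μ * sh ^ 2 * hcμ

theorem isSpacelikeCMC1DCImmersion_fTETilde {μ : ℝ} (hμ : 0 < μ) (hμ1 : μ ≠ 1) :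
    IsSpacelikeCMC1DCImmersion (surfaceTE.dcStructure μ hμ hμ1) (fTETilde μ hμ) := by
  refine ⟨?_, isDCImmersion_fTETilde hμ hμ1, fun p => teNormal μ p, ?_, fun p hp => ?_⟩
  · have : ConnectedSpace (doubleCone 2) := connectedSpace_iff_univ.2 (isConnected_doubleCone 2)
    exact (teHomeomorph μ hμ hμ1).symm.surjective.connectedSpace
      (teHomeomorph μ hμ hμ1).symm.continuous
  · refine (continuousOn_teNormal hμ hμ1).comp continuous_subtype_val.continuousOn fun p hp => ?_
    rwa [mem_ofPred_eq, isDCPoint_surfaceTE_iff, surfaceTE_eq_zero_iff] at hp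
  -- Every point other than the vertex has s ≠ 0 and so lies in the image of the polar
  -- parametrization.
  · obtain ⟨⟨s, θ⟩, rfl⟩ := teProj_surjective μ hμ p
    rw [isDCPoint_surfaceTE_iff, surfaceTE_eq_zero_iff] at hp
    induction θ using Real.Angle.induction_on with
    | _ θ =>
      have hs : s ≠ 0 := hp
      have hE : 0 < ((1 - μ ^ 2) / (2 * μ) * Real.sinh (μ * s)) ^ 2 := by
        have hc := te_const_ne_zero hμ hμ1
        have hsh : Real.sinh (μ * s) ≠ 0 := by
          rw [Ne, Real.sinh_eq_zero]
          exact mul_ne_zero hμ.ne' hs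
        positivity
      refine ⟨{u | u 0 ≠ 0}, tePolar μ hμ, ![s, θ], isLocalParam_tePolar hμ hμ1, hs, rfl, ?_,
        isUnitNormal_teNormal hμ hμ1 (u := ![s, θ]) hs,
        meanCurvature_teNormal hμ hμ1 (u := ![s, θ]) hs⟩
      rw [firstForm_tePolar]
      exact posDef_smul_one_fin_two hE

theorem mainTheorem5 (μ : ℝ) (hμ : 0 < μ) (hμ1 : μ ≠ 1) :
    -- `f_TE^μ` is a real analytic map on `ℝ × T¹` with values in `S³₁`
    AnalyticOnNhd ℝ (fun q : ℝ × ℝ => (fTE μ hμ (q.1, (q.2 : Real.Angle)) : Fin 4 → ℝ)) univ ∧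
    -- it factors through `X_TE^μ`, on which it is realized by the map `f̃_TE^μ`
    Function.Surjective (teProj μ hμ) ∧
    (∀ q, fTE μ hμ q = fTETilde μ hμ (teProj μ hμ q)) ∧
    -- the origin is the only DC-point of `X_TE^μ`
    (∀ p : surfaceTE μ, (surfaceTE.dcStructure μ hμ hμ1).IsDCPoint p ↔ (p : Fin 3 → ℝ) = 0) ∧
    -- `f̃_TE^μ` is a proper real analytic space-like CMC-1 DC-immersion
    IsSpacelikeCMC1DCImmersion (surfaceTE.dcStructure μ hμ hμ1) (fTETilde μ hμ) ∧
    IsProperMap (fTETilde μ hμ) ∧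
    -- the image is analytically complete
    range (fTE μ hμ) = range (fTETilde μ hμ) ∧
    IsAnalyticallyComplete (range (fTE μ hμ)) :=
  ⟨analyticOnNhd_fTE μ hμ, teProj_surjective μ hμ, fTE_eq_fTETilde_teProj μ hμ,
    isDCPoint_surfaceTE_iff hμ hμ1, isSpacelikeCMC1DCImmersion_fTETilde hμ hμ1,
    isProperMap_fTETilde μ hμ hμ1, range_fTE μ hμ,
    range_fTE μ hμ ▸ isAnalyticallyComplete_range_fTETilde hμ hμ1⟩
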